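/- Let $g:\mathbb R^n\times\mathbb R^m\to\mathbb R$ and $G:\mathbb R^n\times\mathbb R^m\to\mathbb R^s$ be $C^2$, with $g(x,\cdot)$ and every component $G_i(x,\cdot)$ convex for each $x\in\mathbb R^n$, and let $h:\mathbb R^s\to[-\infty,\infty]$ be proper, epi-polyhedral (its epigraph is a polyhedral set) and nondecreasing for the componentwise order. Let $h^*$ be the conjugate of $h$, $\partial$ the subdifferential, $\partial^\infty$ the horizon subdifferential, $\operatorname{ri}$ the relative interior, and let $K_{h^*}(p,u)=N_{\partial h^*(p)}(u)$ be the critical cone of $h^*$ at $p$ for $u\in\partial h^*(p)$. For $x\in\mathbb R^n$ and $\alpha,\beta>0$ define $$S(x)=\{(y,p):\ \nabla_y g(x,y)+\nabla_yG(x,y)^\top p=0,\ \ G(x,y)\in\partial h^*(p)\},$$ $$S_{\alpha,\beta}(x)=\{(y,p):\ \nabla_y g(x,y)+\nabla_yG(x,y)^\top p+\beta y=0,\ \ G(x,y)-\alpha p\in\partial h^*(p)\},$$ and let $L(x,y,p)=g(x,y)+\langle G(x,y),p\rangle-h^*(p)$. Let $\bar x\in\mathbb R^n$ and $(\bar y,\bar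 p)\in S(\bar x)$ be such that (i) (basic qualification) $u\in\partial^\infty h(G(\bar x,\bar y))$ and $\nabla_yG(\bar x,\bar y)^\top u=0$ imply $u=0$; (ii) (relative interior condition) $G(\bar x,\bar y)\in\operatorname{ri}(\partial h^*(\bar p))$; (iii) (second-order condition) with $\bar K=K_{h^*}(\bar p,G(\bar x,\bar y))$, whenever $w\in\mathbb R^m$ and $z\in\bar K$ satisfy $-\nabla_yG(\bar x,\bar y)^\top z=\nabla^2_{yy}L(\bar x,\bar y,\bar p)w$ and $-\nabla_yG(\bar x,\bar y)w\in\bar K^\perp$, then $w=0$ and $z=0$. Let $x^\nu\to\bar x$, $\alpha^\nu\to0$ and $\beta^\nu\to0$ with $\alpha^\nu,\beta^\nu>0$. Then $S_{\alpha^\nu,\beta^\nu}$ is single-valued on $\mathbb R^n$ for every $\nu$; $S(\bar x)=\{(\bar y,\bar p)\}$, and $S$ is single-valued in a neighborhood of $\bar x$ and $C^1$ there; and (identifying single-valued mappings with functions) $$S_{\alpha^\nu,\beta^\nu}(x^\nu)\to(\bar y,\bar p),\qquad S_{\alpha^\nu,\beta^\nu}\text{ is }C^1\text{ in a neighborhood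 of }x^\nu\text{ for all sufficiently large }\nu,\qquad \nabla S_{\alpha^\nu,\beta^\nu}(x^\nu)\to\nabla S(\bar x).$$ -/

import Mathlib

open Set Filter Topology
open scoped RealInnerProductSpace

noncomputable section

namespace Bilevel

/-! ### Convex analysis in `ℝᵏ` with extended-real-valued functions -/

section ConvexAnalysis

variable {k : ℕ}

/-- The epigraph `{(z, t) ∈ ℝᵏ × ℝ | φ z ≤ t}`. -/
def epi (φ : EuclideanSpace ℝ (Fin k) → EReal) : Set (EuclideanSpace ℝ (Fin k) × ℝ) :=
  {zt | φ zt.1 ≤ (zt.2 : EReal)}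

/-- A polyhedral set: an intersection of finitely many closed half-spaces. -/
def IsPolyhedralSet {V : Type*} [TopologicalSpace V] [AddCommGroup V] [Module ℝ V]
    (C : Set V) : Prop :=
  ∃ (N : ℕ) (l : Fin N → (V →L[ℝ] ℝ)) (r : Fin N → ℝ), C = {v | ∀ i, l i v ≤ r i}

/-- `φ` is epi-polyhedral: its epigraph is a polyhedral set. -/
def EpiPolyhedral (φ : EuclideanSpace ℝ (Fin k) → EReal) : Prop :=
  IsPolyhedralSet (epi φ)

/-- `φ` is proper: it is not identically `∞` and never takes the value `-∞`. -/
def Proper (φ : EuclideanSpace ℝ (Fin k) → EReal) : Prop :=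
  (∃ z, φ z < ⊤) ∧ ∀ z, φ z ≠ ⊥

/-- `φ` is nondecreasing for the componentwise order. -/
def Nondecreasing (φ : EuclideanSpace ℝ (Fin k) → EReal) : Prop :=
  ∀ z z' : EuclideanSpace ℝ (Fin k), (∀ i, z i ≤ z' i) → φ z ≤ φ z'

/-- The conjugate `φ*(p) = sup_z {⟨p, z⟩ - φ z}`. -/
def conj (φ : EuclideanSpace ℝ (Fin k) → EReal) (p : EuclideanSpace ℝ (Fin k)) : EReal :=
  ⨆ z, ((⟪p, z⟫ : ℝ) : EReal) - φ z

/-- The subdifferential `∂φ(z)` of a convex function at a point where it is finite (it is empty at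
all other points): `(u, -1)` is normal to `epi φ` at `(z, φ z)`. -/
def subdiff (φ : EuclideanSpace ℝ (Fin k) → EReal) (z : EuclideanSpace ℝ (Fin k)) :
    Set (EuclideanSpace ℝ (Fin k)) :=
  {u | φ z ≠ ⊥ ∧ φ z ≠ ⊤ ∧ ∀ z', φ z + ((⟪u, z' - z⟫ : ℝ) : EReal) ≤ φ z'}

/-- The horizon subdifferential `∂^∞φ(z)` of a convex function at a point where it is finite (it is
empty at all other points): `(u, 0)` is normal to `epi φ` at `(z, φ z)`. -/
def horizonSubdiff (φ : EuclideanSpace ℝ (Fin k) → EReal) (z : EuclideanSpace ℝ (Fin k)) :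
    Set (EuclideanSpace ℝ (Fin k)) :=
  {u | φ z ≠ ⊥ ∧ φ z ≠ ⊤ ∧ ∀ zt ∈ epi φ, ⟪u, zt.1 - z⟫ ≤ 0}

/-- The normal cone `N_C(u)` to a convex set `C` at a point `u ∈ C`. -/
def normalCone (C : Set (EuclideanSpace ℝ (Fin k))) (u : EuclideanSpace ℝ (Fin k)) :
    Set (EuclideanSpace ℝ (Fin k)) :=
  {v | ∀ c ∈ C, ⟪v, c - u⟫ ≤ 0}

/-- The critical cone `K_φ(z, u) = N_{∂φ(z)}(u)` of a convex function, for `u ∈ ∂φ(z)`. -/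
def criticalCone (φ : EuclideanSpace ℝ (Fin k) → EReal) (z u : EuclideanSpace ℝ (Fin k)) :
    Set (EuclideanSpace ℝ (Fin k)) :=
  normalCone (subdiff φ z) u

/-- The orthogonal complement `C^⊥` of a set. -/
def orth (C : Set (EuclideanSpace ℝ (Fin k))) : Set (EuclideanSpace ℝ (Fin k)) :=
  {v | ∀ c ∈ C, ⟪c, v⟫ = 0}

end ConvexAnalysis

/-! ### The lower-level problem `min_y g(x, y) + h(G(x, y))` and its regularization -/

section LowerLevel

variable {n m s : ℕ}

/-- The standing assumptions on the lower-level data: `g` and `G` are `C²` in `(x, y)`, `g` and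
every component of `G` are convex in `y`, and `h` is proper, epi-polyhedral and nondecreasing. -/
structure StandingAssumptions
    (g : EuclideanSpace ℝ (Fin n) → EuclideanSpace ℝ (Fin m) → ℝ)
    (G : EuclideanSpace ℝ (Fin n) → EuclideanSpace ℝ (Fin m) → EuclideanSpace ℝ (Fin s))
    (h : EuclideanSpace ℝ (Fin s) → EReal) : Prop where
  contDiff_g : ContDiff ℝ 2
    (fun q : EuclideanSpace ℝ (Fin n) × EuclideanSpace ℝ (Fin m) => g q.1 q.2)
  contDiff_G : ContDiff ℝ 2
    (fun q : EuclideanSpace ℝ (Fin n) × EuclideanSpace ℝ (Fin m) => G q.1 q.2)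
  convex_g : ∀ x, ConvexOn ℝ univ (fun y => g x y)
  convex_G : ∀ x i, ConvexOn ℝ univ (fun y => G x y i)
  proper_h : Proper h
  epiPolyhedral_h : EpiPolyhedral h
  nondecreasing_h : Nondecreasing h

/-- The partial gradient `∇_y g(x, y)`. -/
def gradY (g : EuclideanSpace ℝ (Fin n) → EuclideanSpace ℝ (Fin m) → ℝ)
    (x : EuclideanSpace ℝ (Fin n)) (y : EuclideanSpace ℝ (Fin m)) : EuclideanSpace ℝ (Fin m) :=
  gradient (fun y' => g x y') y

/-- The partial Jacobian `∇_y G(x, y)`, as a linear map. -/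
def jacY (G : EuclideanSpace ℝ (Fin n) → EuclideanSpace ℝ (Fin m) → EuclideanSpace ℝ (Fin s))
    (x : EuclideanSpace ℝ (Fin n)) (y : EuclideanSpace ℝ (Fin m)) :
    EuclideanSpace ℝ (Fin m) →L[ℝ] EuclideanSpace ℝ (Fin s) :=
  fderiv ℝ (fun y' => G x y') y

/-- The transposed partial Jacobian `∇_y G(x, y)ᵀ`. -/
def jacYT (G : EuclideanSpace ℝ (Fin n) → EuclideanSpace ℝ (Fin m) → EuclideanSpace ℝ (Fin s))
    (x : EuclideanSpace ℝ (Fin n)) (y : EuclideanSpace ℝ (Fin m)) :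
    EuclideanSpace ℝ (Fin s) →L[ℝ] EuclideanSpace ℝ (Fin m) :=
  ContinuousLinearMap.adjoint (jacY G x y)

/-- The Lagrangian `L(x, y, p) = g(x, y) + ⟨G(x, y), p⟩ - h*(p)`, for `p ∈ dom h*`. -/
def lagrangian (g : EuclideanSpace ℝ (Fin n) → EuclideanSpace ℝ (Fin m) → ℝ)
    (G : EuclideanSpace ℝ (Fin n) → EuclideanSpace ℝ (Fin m) → EuclideanSpace ℝ (Fin s))
    (h : EuclideanSpace ℝ (Fin s) → EReal)
    (x : EuclideanSpace ℝ (Fin n)) (y : EuclideanSpace ℝ (Fin m))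
    (p : EuclideanSpace ℝ (Fin s)) : ℝ :=
  g x y + ⟪G x y, p⟫ - (conj h p).toReal

/-- The Hessian `∇²_yy L(x, y, p)` of the Lagrangian in `y`, as a linear map. -/
def hessLagrangian (g : EuclideanSpace ℝ (Fin n) → EuclideanSpace ℝ (Fin m) → ℝ)
    (G : EuclideanSpace ℝ (Fin n) → EuclideanSpace ℝ (Fin m) → EuclideanSpace ℝ (Fin s))
    (h : EuclideanSpace ℝ (Fin s) → EReal)
    (x : EuclideanSpace ℝ (Fin n)) (y : EuclideanSpace ℝ (Fin m))
    (p : EuclideanSpace ℝ (Fin s)) :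
    EuclideanSpace ℝ (Fin m) →L[ℝ] EuclideanSpace ℝ (Fin m) :=
  fderiv ℝ (fun y' => gradient (fun y'' => lagrangian g G h x y'' p) y') y

/-- `S_{α,β}(x)`: the pairs `(y, p)` that solve the optimality system of the regularized
lower-level problem,
`0 = -∇_y g(x, y) - ∇_y G(x, y)ᵀ p - β y` and `0 ∈ -G(x, y) + α p + ∂h*(p)`. -/
def solReg (g : EuclideanSpace ℝ (Fin n) → EuclideanSpace ℝ (Fin m) → ℝ)
    (G : EuclideanSpace ℝ (Fin n) → EuclideanSpace ℝ (Fin m) → EuclideanSpace ℝ (Fin s))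
    (h : EuclideanSpace ℝ (Fin s) → EReal) (α β : ℝ) (x : EuclideanSpace ℝ (Fin n)) :
    Set (EuclideanSpace ℝ (Fin m) × EuclideanSpace ℝ (Fin s)) :=
  {yp | -gradY g x yp.1 - jacYT G x yp.1 yp.2 - β • yp.1 = 0 ∧
    G x yp.1 - α • yp.2 ∈ subdiff (conj h) yp.2}

/-- `S(x)`: the pairs `(y, p)` that solve the optimality system of the lower-level problem,
`0 = -∇_y g(x, y) - ∇_y G(x, y)ᵀ p` and `0 ∈ -G(x, y) + ∂h*(p)`. -/
def sol (g : EuclideanSpace ℝ (Fin n) → EuclideanSpace ℝ (Fin m) → ℝ)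
    (G : EuclideanSpace ℝ (Fin n) → EuclideanSpace ℝ (Fin m) → EuclideanSpace ℝ (Fin s))
    (h : EuclideanSpace ℝ (Fin s) → EReal) (x : EuclideanSpace ℝ (Fin n)) :
    Set (EuclideanSpace ℝ (Fin m) × EuclideanSpace ℝ (Fin s)) :=
  {yp | -gradY g x yp.1 - jacYT G x yp.1 yp.2 = 0 ∧ G x yp.1 ∈ subdiff (conj h) yp.2}

/-- The basic qualification at `y` for `x`:
`u ∈ ∂^∞h(G(x, y))` and `∇_y G(x, y)ᵀ u = 0` imply `u = 0`. -/
def BasicQualification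
    (G : EuclideanSpace ℝ (Fin n) → EuclideanSpace ℝ (Fin m) → EuclideanSpace ℝ (Fin s))
    (h : EuclideanSpace ℝ (Fin s) → EReal)
    (x : EuclideanSpace ℝ (Fin n)) (y : EuclideanSpace ℝ (Fin m)) : Prop :=
  ∀ u ∈ horizonSubdiff h (G x y), jacYT G x y u = 0 → u = 0

/-- The second-order condition at `(x, y, p)`: with `K = K_{h*}(p, G(x, y))`, the relations
`z ∈ K`, `-∇_y G(x, y)ᵀ z = ∇²_yy L(x, y, p) w` and `-∇_y G(x, y) w ∈ K^⊥` imply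
`w = 0` and `z = 0`. -/
def SecondOrderCondition
    (g : EuclideanSpace ℝ (Fin n) → EuclideanSpace ℝ (Fin m) → ℝ)
    (G : EuclideanSpace ℝ (Fin n) → EuclideanSpace ℝ (Fin m) → EuclideanSpace ℝ (Fin s))
    (h : EuclideanSpace ℝ (Fin s) → EReal)
    (x : EuclideanSpace ℝ (Fin n)) (y : EuclideanSpace ℝ (Fin m))
    (p : EuclideanSpace ℝ (Fin s)) : Prop :=
  ∀ (w : EuclideanSpace ℝ (Fin m)) (z : EuclideanSpace ℝ (Fin s)),
    z ∈ criticalCone (conj h) p (G x y) →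
    -jacYT G x y z = hessLagrangian g G h x y p w →
    -jacY G x y w ∈ orth (criticalCone (conj h) p (G x y)) →
    w = 0 ∧ z = 0

end LowerLevel

end Bilevel

end

/-! Since `epi h` is closed and convex, `u ∈ ∂h*(p)` means that some affine function `⟨p, ·⟩ - c`
minorizes `h` and touches it at `u` (`mem_subdiff_conj_iff`). This replaces `EReal` conjugates by
inequalities over `epi h`, and the real number `c` plays the role of `h*(p)`.

The key is polyhedrality together with the relative interior condition: near `(pbar, G xbar ybar)`
the graph of `∂h*` is an affine subspace, `p - pbar ∈ Vᗮ` and `u - G xbar ybar ∈ V`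
(`exists_submodule_eventually_contact_iff`), and the critical cone is exactly `Vᗮ`. The generalized
equation thus becomes locally a `C¹` equation in `(y, p)` with parameters `(x, α, β)`, and the
second-order condition says that its partial derivative is injective. The implicit function theorem
yields one `C¹` map `σ(x, α, β)` that describes both `S`, at `α = β = 0`, and `S_{α,β}` near the
base point (`exists_implicit_solution`).

Convexity makes this local picture global. `S(x)` is convex, being a set of saddle points
(`convex_sol`), so an isolated point of it is all of it. `S_{α,β}(x)` is a singleton by strong
monotonicity (`solReg_subsingleton`) and by existence of a minimizer of a penalized problem
(`solReg_nonempty`). Every limit in the theorem is then continuity of `σ` and of its derivative. -/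

namespace Bilevel

/-! ### Subgradients of the conjugate as touching affine minorants. -/

section Conjugate

variable {k : ℕ} {φ : EuclideanSpace ℝ (Fin k) → EReal}

lemma IsPolyhedralSet.isClosed {V : Type*} [TopologicalSpace V] [AddCommGroup V] [Module ℝ V]
    {C : Set V} (hC : IsPolyhedralSet C) : IsClosed C := by
  obtain ⟨N, l, r, rfl⟩ := hC
  simp only [ofPred_forall]
  exact isClosed_iInter fun i => isClosed_le (l i).continuous continuous_const

lemma IsPolyhedralSet.convex {V : Type*} [TopologicalSpace V] [AddCommGroup V] [Module ℝ V]
    {C : Set V} (hC : IsPolyhedralSet C) : Convex ℝ C := by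
  obtain ⟨N, l, r, rfl⟩ := hC
  simp only [ofPred_forall]
  exact convex_iInter fun i => convex_halfSpace_le (l i).toLinearMap.isLinear (r i)

lemma Proper.epi_nonempty (hφ : Proper φ) : (epi φ).Nonempty := by
  obtain ⟨z, hz⟩ := hφ.1
  exact ⟨(z, (φ z).toReal), EReal.le_coe_toReal hz.ne⟩

lemma coe_sub_le_iff {a c : ℝ} {e : EReal} (he : e ≠ ⊥) :
    (a : EReal) - e ≤ c ↔ ∀ t : ℝ, e ≤ t → a - t ≤ c := by
  induction e with
  | bot => exact absurd rfl he
  | top => simp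
  | coe e =>
    rw [← EReal.coe_sub, EReal.coe_le_coe_iff]
    refine ⟨fun h t ht => ?_, fun h => h e le_rfl⟩
    have := EReal.coe_le_coe_iff.1 ht
    linarith

lemma conj_le_iff (hφ : Proper φ) {p : EuclideanSpace ℝ (Fin k)} {c : ℝ} :
    conj φ p ≤ c ↔ ∀ zt ∈ epi φ, ⟪p, zt.1⟫ - zt.2 ≤ c := by
  rw [conj, iSup_le_iff]
  refine ⟨fun h zt hzt => (coe_sub_le_iff (hφ.2 _)).1 (h zt.1) _ hzt, fun h z => ?_⟩
  exact (coe_sub_le_iff (hφ.2 _)).2 fun t ht => h (z, t) ht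

lemma le_conj_of_mem_epi {p z : EuclideanSpace ℝ (Fin k)} {t : ℝ} (hz : (z, t) ∈ epi φ) :
    ((⟪p, z⟫ - t : ℝ) : EReal) ≤ conj φ p := by
  refine le_trans ?_ (le_iSup _ z)
  rw [EReal.coe_sub]
  exact EReal.sub_le_sub le_rfl hz

/-- Fenchel's equality case: `u ∈ ∂φ*(p)` means that the affine function `⟨p, ·⟩ - c` minorizes
`φ` and touches it at `u`. -/
theorem mem_subdiff_conj_iff (hφ : Proper φ) (hclosed : IsClosed (epi φ))
    (hconv : Convex ℝ (epi φ)) {p u : EuclideanSpace ℝ (Fin k)} :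
    u ∈ subdiff (conj φ) p ↔
      ∃ c : ℝ, (∀ zt ∈ epi φ, ⟪p, zt.1⟫ - zt.2 ≤ c) ∧ (u, ⟪p, u⟫ - c) ∈ epi φ := by
  constructor
  · rintro ⟨hbot, htop, hsub⟩
    obtain ⟨c, hc⟩ : ∃ c : ℝ, conj φ p = c := ⟨_, (EReal.coe_toReal htop hbot).symm⟩
    have hpc := (conj_le_iff hφ (p := p) (c := c)).1 hc.le
    refine ⟨c, hpc, ?_⟩
    by_contra hnot
    obtain ⟨f, a, hfa, haf⟩ := geometric_hahn_banach_closed_point hconv hclosed hnot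
    set b := f (0, 1)
    set q := (InnerProductSpace.toDual ℝ (EuclideanSpace ℝ (Fin k))).symm
      (f.comp (ContinuousLinearMap.inl ℝ _ _))
    have hf : ∀ z t, f (z, t) = ⟪q, z⟫ + t * b := by
      intro z t
      have : ((z, t) : EuclideanSpace ℝ (Fin k) × ℝ) = (z, 0) + t • (0, 1) := by simp
      rw [this, map_add, map_smul, InnerProductSpace.toDual_symm_apply]
      simp [b]
    obtain ⟨⟨z₀, t₀⟩, hz₀⟩ := hφ.epi_nonempty
    -- The epigraph is unbounded upwards while `f < a` on it. The case `b = 0`, a vertical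
    -- hyperplane, is not excluded.
    have hb : b ≤ 0 := by
      by_contra! hb
      have h1 := hfa (z₀, t₀ + (|a - f (z₀, t₀)|) / b) (by
        have h0 : φ z₀ ≤ t₀ := hz₀
        refine h0.trans (EReal.coe_le_coe_iff.2 ?_)
        have : 0 ≤ |a - f (z₀, t₀)| / b := by positivity
        linarith)
      rw [hf] at h1
      have h2 := le_abs_self (a - f (z₀, t₀))
      rw [hf z₀ t₀] at h1 h2
      have : (|a - (⟪q, z₀⟫ + t₀ * b)|) / b * b = |a - (⟪q, z₀⟫ + t₀ * b)| := by field_simp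
      nlinarith
    have hb1 : 0 < 1 - b := by linarith
    -- Adding the known minorant, of normal `(p, -1)`, to the separating functional `(q, b)` gives
    -- the last coordinate `b - 1 < 0`. This covers vertical hyperplanes too, and rescaling gives a
    -- slope at which the subgradient inequality contradicts the separation.
    have h1 : conj φ ((1 - b)⁻¹ • (p + q)) ≤ (((1 - b)⁻¹ * (c + a) : ℝ) : EReal) := by
      rw [conj_le_iff hφ]
      rintro ⟨z, t⟩ hzt
      have h2 := hpc _ hzt
      have h3 := (hfa _ hzt).le
      rw [hf] at h3
      simp only [inner_smul_left, inner_add_left] at h2 ⊢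
      rw [← sub_nonneg]
      have : 0 ≤ (1 - b)⁻¹ * (c + a - (⟪p, z⟫ + ⟪q, z⟫ - (1 - b) * t)) := by
        apply mul_nonneg (by positivity); linarith
      convert! this using 1
      simp; field_simp
    have h2 := (hsub ((1 - b)⁻¹ • (p + q))).trans h1
    rw [hc, ← EReal.coe_add, EReal.coe_le_coe_iff] at h2
    rw [hf] at haf
    simp only [inner_sub_right, inner_smul_right, inner_add_right, real_inner_comm p u,
      real_inner_comm q u] at h2
    have h3 := mul_le_mul_of_nonneg_left h2 hb1.le
    have e1 : (1 - b) * ((1 - b)⁻¹ * (c + a)) = c + a := by field_simp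
    have e2 : (1 - b) * (c + ((1 - b)⁻¹ * (⟪p, u⟫ + ⟪q, u⟫) - ⟪p, u⟫)) =
      (1 - b) * c + (⟪p, u⟫ + ⟪q, u⟫) - (1 - b) * ⟪p, u⟫ := by field_simp; ring
    rw [e1, e2] at h3
    nlinarith
  · rintro ⟨c, hpc, hu⟩
    have hc : conj φ p = c := by
      refine le_antisymm ((conj_le_iff hφ).2 hpc) ?_
      simpa using le_conj_of_mem_epi (p := p) hu
    refine ⟨by simp [hc], by simp [hc], fun p' => ?_⟩
    rw [hc, ← EReal.coe_add]
    convert! le_conj_of_mem_epi (p := p') hu using 2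
    rw [inner_sub_right, real_inner_comm p u, real_inner_comm p' u]; ring

/-- Lowering one coordinate stays in the epigraph at the same height, so a negative `p i` would make
`⟨p, z⟩ - t` unbounded there. The step `a` is chosen to overshoot `c`. This sign makes `g x + ⟨p, G
x⟩` convex. -/
lemma nonneg_of_affine_minorant (hφ : Proper φ) (hmono : Nondecreasing φ)
    {p : EuclideanSpace ℝ (Fin k)} {c : ℝ} (hp : ∀ zt ∈ epi φ, ⟪p, zt.1⟫ - zt.2 ≤ c)
    (i : Fin k) : 0 ≤ p i := by
  obtain ⟨⟨z, t⟩, hz⟩ := hφ.epi_nonempty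
  by_contra! hi
  set a := (|c - (⟪p, z⟫ - t)| + 1) / (-p i) with ha
  have ha0 : 0 ≤ a := by
    have : 0 < -p i := by linarith
    positivity
  have h1 := hp (z - a • EuclideanSpace.single i 1, t) (by
    refine le_trans (hmono _ z fun j => ?_) hz
    by_cases hj : j = i
    · subst hj; simpa using ha0
    · simp [hj])
  have h2 : ⟪p, z - a • EuclideanSpace.single i (1 : ℝ)⟫ = ⟪p, z⟫ - a * p i := by
    simp [inner_sub_right, inner_smul_right, EuclideanSpace.inner_single_right]
  have h3 : a * (-p i) = |c - (⟪p, z⟫ - t)| + 1 := by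
    rw [ha, div_mul_cancel₀]; linarith
  simp only [h2] at h1
  have := le_abs_self (c - (⟪p, z⟫ - t))
  linarith

end Conjugate

/-! ### Local affine structure of the contact relation for polyhedral epigraphs. -/

section PolyhedralReduction

/-- The line through `c` and `u` stays in the affine span, so a neighbourhood of `u` in that span
lets the segment from `c` be prolonged past `u`. -/
lemma exists_pos_sub_smul_mem {E : Type*} [NormedAddCommGroup E] [NormedSpace ℝ E] {M : Set E}
    {u c : E} (hu : u ∈ intrinsicInterior ℝ M) (hc : c ∈ M) :
    ∃ ε > (0 : ℝ), u - ε • (c - u) ∈ M := by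
  obtain ⟨⟨u, hu'⟩, hint, rfl⟩ := mem_intrinsicInterior.1 hu
  have hcA : c ∈ affineSpan ℝ M := subset_affineSpan ℝ M hc
  have hmem : ∀ ε : ℝ, AffineMap.lineMap u c (-ε) ∈ affineSpan ℝ M := fun ε =>
    AffineMap.lineMap_mem _ hu' hcA
  let γ : ℝ → affineSpan ℝ M := fun ε => ⟨AffineMap.lineMap u c (-ε), hmem ε⟩
  have hγ : Continuous γ := by
    apply Continuous.subtype_mk
    simp only [AffineMap.lineMap_apply]
    simp only [vsub_eq_sub, vadd_eq_add]
    fun_prop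
  have hγ0 : γ 0 = ⟨u, hu'⟩ := by simp [γ]
  have h1 : ∀ᶠ ε in 𝓝 (0 : ℝ), γ ε ∈ ((↑) ⁻¹' M : Set (affineSpan ℝ M)) := by
    apply hγ.continuousAt
    rw [hγ0]
    exact mem_interior_iff_mem_nhds.1 hint
  obtain ⟨ε, h2, hε⟩ := ((h1.filter_mono nhdsWithin_le_nhds).and
    (self_mem_nhdsWithin : Ioi (0 : ℝ) ∈ 𝓝[>] 0)).exists
  refine ⟨ε, hε, ?_⟩
  have : (γ ε : E) ∈ M := h2
  simp only [γ, AffineMap.lineMap_apply, vsub_eq_sub, vadd_eq_add] at this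
  convert! this using 1
  module

variable {E : Type*} [NormedAddCommGroup E] [InnerProductSpace ℝ E] [FiniteDimensional ℝ E]

/-- Reduction lemma for polyhedral functions: at a pair `(p₀, u₀)` with `u₀` in the relative
interior of the contact set `M`, the relation "`⟨p, ·⟩ - c` minorizes the polyhedral epigraph and
touches it at `u`" is locally the affine subspace `p - p₀ ∈ Vᗮ`, `u - u₀ ∈ V`. -/
theorem exists_submodule_eventually_contact_iff {P : Set (E × ℝ)} (hP : IsPolyhedralSet P)
    {p₀ u₀ : E} {c₀ : ℝ} (hp₀ : ∀ zt ∈ P, ⟪p₀, zt.1⟫ - zt.2 ≤ c₀)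
    (hu₀ : (u₀, ⟪p₀, u₀⟫ - c₀) ∈ P)
    (hri : ∀ c, (c, ⟪p₀, c⟫ - c₀) ∈ P →
      ∃ ε > (0 : ℝ), (u₀ - ε • (c - u₀), ⟪p₀, u₀ - ε • (c - u₀)⟫ - c₀) ∈ P) :
    ∃ V : Submodule ℝ E,
      (∀ k, k ∈ Vᗮ ↔ ∀ c, (c, ⟪p₀, c⟫ - c₀) ∈ P → ⟪k, c - u₀⟫ ≤ 0) ∧
      ∀ᶠ pu : E × E in 𝓝 (p₀, u₀),
        ((∃ c : ℝ, (∀ zt ∈ P, ⟪pu.1, zt.1⟫ - zt.2 ≤ c) ∧ (pu.2, ⟪pu.1, pu.2⟫ - c) ∈ P) ↔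
          pu.1 - p₀ ∈ Vᗮ ∧ pu.2 - u₀ ∈ V) := by
  obtain ⟨N, l, r, rfl⟩ := hP
  set t₀ := ⟪p₀, u₀⟫ - c₀ with ht₀
  set P := {v : E × ℝ | ∀ i, l i v ≤ r i} with hPdef
  let act : Fin N → Prop := fun i => l i (u₀, t₀) = r i
  -- Directions along the graph of the minorant `⟨p₀, ·⟩ - c₀` in which all active constraints stay
  -- tight.
  let V : Submodule ℝ E :=
    { carrier := {d | ∀ i, act i → l i (d, ⟪p₀, d⟫) = 0}
      add_mem' := by
        intro a b ha hb i hi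
        have : ((a + b, ⟪p₀, a + b⟫) : E × ℝ) = (a, ⟪p₀, a⟫) + (b, ⟪p₀, b⟫) := by
          simp [inner_add_right]
        rw [this, map_add, ha i hi, hb i hi, add_zero]
      zero_mem' := by intro i _; simp [← Prod.zero_eq_mk]
      smul_mem' := by
        intro t a ha i hi
        have : ((t • a, ⟪p₀, t • a⟫) : E × ℝ) = t • (a, ⟪p₀, a⟫) := by
          simp [inner_smul_right]
        rw [this, map_smul, ha i hi, smul_zero] }
  have hV : ∀ d, d ∈ V ↔ ∀ i, act i → l i (d, ⟪p₀, d⟫) = 0 := fun d => Iff.rfl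
  -- The tangent cone of `P` at `(u₀, t₀)`, sheared so that the second coordinate is the height
  -- above the minorant. As only finitely many constraints occur, `P` and this cone agree near the
  -- point.
  let C : Set (E × ℝ) := {w | ∀ i, act i → l i (w.1, ⟪p₀, w.1⟫ + w.2) ≤ 0}
  have hC : ∀ d τ, (d, τ) ∈ C ↔ ∀ i, act i → l i (d, ⟪p₀, d⟫ + τ) ≤ 0 := fun d τ => Iff.rfl
  have hCclosed : IsClosed C := by
    simp only [C, ofPred_forall]
    refine isClosed_iInter fun i => isClosed_iInter fun _ => isClosed_le ?_ continuous_const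
    fun_prop
  have hPC : ∀ z t, (z, t) ∈ P → (z - u₀, t - t₀ - ⟪p₀, z - u₀⟫) ∈ C := by
    intro z t hz i hi
    have h1 : l i (z, t) ≤ r i := hz i
    have h2 : l i (u₀, t₀) = r i := hi
    have : ((z - u₀, ⟪p₀, z - u₀⟫ + (t - t₀ - ⟪p₀, z - u₀⟫)) : E × ℝ) = (z, t) - (u₀, t₀) := by
      ext <;> simp
    show l i (z - u₀, ⟪p₀, z - u₀⟫ + (t - t₀ - ⟪p₀, z - u₀⟫)) ≤ 0
    rw [this, map_sub]; linarith
  have hMC : ∀ c, (c, ⟪p₀, c⟫ - c₀) ∈ P → (c - u₀, (0 : ℝ)) ∈ C := by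
    intro c hc
    have := hPC _ _ hc
    rwa [show ⟪p₀, c⟫ - c₀ - t₀ - ⟪p₀, c - u₀⟫ = 0 by rw [inner_sub_right, ht₀]; ring] at this
  have hCsmul : ∀ d τ (a : ℝ), 0 ≤ a → (d, τ) ∈ C → (a • d, a * τ) ∈ C := by
    intro d τ a ha hd i hi
    have : ((a • d, ⟪p₀, a • d⟫ + a * τ) : E × ℝ) = a • (d, ⟪p₀, d⟫ + τ) := by
      simp [inner_smul_right, mul_add]
    show l i (a • d, ⟪p₀, a • d⟫ + a * τ) ≤ 0
    rw [this, map_smul]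
    exact mul_nonpos_of_nonneg_of_nonpos ha (hd i hi)
  have hCloc : ∀ᶠ w : E × ℝ in 𝓝 0, w ∈ C → (u₀ + w.1, t₀ + (⟪p₀, w.1⟫ + w.2)) ∈ P := by
    have h1 : ∀ᶠ w : E × ℝ in 𝓝 0, ∀ i, ¬ act i → l i (u₀ + w.1, t₀ + (⟪p₀, w.1⟫ + w.2)) < r i := by
      refine eventually_all.2 fun i => ?_
      by_cases hi : act i
      · simp [hi]
      · have hlt : l i (u₀, t₀) < r i := lt_of_le_of_ne (hu₀ i) hi
        have hcont : Continuous fun w : E × ℝ => l i (u₀ + w.1, t₀ + (⟪p₀, w.1⟫ + w.2)) := by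
          fun_prop
        have := hcont.continuousAt (x := 0) |>.eventually_lt_const (u := r i) (by simpa using hlt)
        filter_upwards [this] with w hw _ using hw
    filter_upwards [h1] with w hw hwC i
    by_cases hi : act i
    · have h2 : l i (u₀, t₀) = r i := hi
      have h3 : l i (w.1, ⟪p₀, w.1⟫ + w.2) ≤ 0 := hwC i hi
      have : ((u₀ + w.1, t₀ + (⟪p₀, w.1⟫ + w.2)) : E × ℝ) = (u₀, t₀) + (w.1, ⟪p₀, w.1⟫ + w.2) := rfl
      rw [this, map_add]; linarith
    · exact (hw i hi).le
  have hCscale : ∀ d τ, (d, τ) ∈ C →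
      ∃ ε > (0 : ℝ), (u₀ + ε • d, t₀ + (⟪p₀, ε • d⟫ + ε * τ)) ∈ P := by
    intro d τ hd
    have hcont : Continuous fun ε : ℝ => ((ε • d, ε * τ) : E × ℝ) := by fun_prop
    have h0 : Tendsto (fun ε : ℝ => ((ε • d, ε * τ) : E × ℝ)) (𝓝 0) (𝓝 0) := by
      have := hcont.tendsto 0
      simpa [← Prod.zero_eq_mk] using this
    obtain ⟨ε, h2, hε⟩ := (((h0.eventually hCloc).filter_mono nhdsWithin_le_nhds).and
      (self_mem_nhdsWithin : Ioi (0 : ℝ) ∈ 𝓝[>] 0)).exists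
    exact ⟨ε, hε, h2 (hCsmul d τ ε (le_of_lt hε) hd)⟩
  have hCnonneg : ∀ d τ, (d, τ) ∈ C → 0 ≤ τ := by
    intro d τ hd
    obtain ⟨ε, hε, hmem⟩ := hCscale d τ hd
    have h1 := hp₀ _ hmem
    simp only [inner_add_right] at h1
    have h2 : 0 ≤ ε * τ := by linarith
    exact nonneg_of_mul_nonneg_right h2 hε
  have hVC : ∀ d, d ∈ V → (d, (0 : ℝ)) ∈ C := by
    intro d hd i hi
    have := hd i hi
    simpa using this.le
  -- The only use of `hri`: a contact direction has a reversed multiple that is also a contact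
  -- direction, so each active constraint is both `≤ 0` and `≥ 0` along it.
  have hCV : ∀ d, (d, (0 : ℝ)) ∈ C → d ∈ V := by
    intro d hd i hi
    obtain ⟨ε, hε, hmem⟩ := hCscale d 0 hd
    have hmem' : (u₀ + ε • d, ⟪p₀, u₀ + ε • d⟫ - c₀) ∈ P := by
      convert! hmem using 2
      rw [inner_add_right, ht₀]; ring
    obtain ⟨ε', hε', hmem''⟩ := hri _ hmem'
    have h1 := hMC _ hmem'' i hi
    have h2 := hd i hi
    simp only [add_zero] at h1 h2
    refine le_antisymm h2 ?_
    have h3 : ((u₀ - ε' • (u₀ + ε • d - u₀) - u₀, ⟪p₀, u₀ - ε' • (u₀ + ε • d - u₀) - u₀⟫) : E × ℝ)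
        = (-(ε' * ε)) • (d, ⟪p₀, d⟫) := by
      have : u₀ - ε' • (u₀ + ε • d - u₀) - u₀ = (-(ε' * ε)) • d := by module
      rw [this, inner_smul_right]; simp
    rw [h3, map_smul, smul_eq_mul] at h1
    have : 0 < ε' * ε := by positivity
    nlinarith
  have hVsmall : ∃ ρ > 0, ∀ v ∈ V, ‖v‖ < ρ → (u₀ + v, ⟪p₀, u₀ + v⟫ - c₀) ∈ P := by
    have hcont : Continuous fun v : E => ((v, 0) : E × ℝ) := by fun_prop
    have h0 : Tendsto (fun v : E => ((v, 0) : E × ℝ)) (𝓝 0) (𝓝 0) := hcont.tendsto 0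
    obtain ⟨ρ, hρ, hball⟩ := Metric.eventually_nhds_iff.1 (h0.eventually hCloc)
    refine ⟨ρ, hρ, fun v hv hn => ?_⟩
    convert! hball (y := v) (by simpa using hn) (hVC v hv) using 2
    simp only [inner_add_right, ht₀]; ring
  -- Sharp growth transversally to `V`: on unit vectors of `Vᗮ` the height is positive by `hCV`, and
  -- compactness makes it uniformly so. Heights above `1` are cut off for compactness and are
  -- covered by `δ ≤ 1`.
  have hsharp : ∃ δ > 0, ∀ d τ, (d, τ) ∈ C → d ∈ Vᗮ → δ * ‖d‖ ≤ τ := by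
    let Q : Set (E × ℝ) := C ∩ {w | w.1 ∈ Vᗮ} ∩ (Metric.sphere 0 1 ×ˢ Icc 0 1)
    have hQ : IsCompact Q := by
      refine IsCompact.inter_left ((isCompact_sphere 0 1).prod isCompact_Icc) ?_
      exact hCclosed.inter ((Submodule.isClosed_orthogonal V).preimage continuous_fst)
    have key : ∃ δ > 0, δ ≤ 1 ∧ ∀ w ∈ Q, δ ≤ w.2 := by
      rcases Q.eq_empty_or_nonempty with hQe | hQn
      · exact ⟨1, one_pos, le_rfl, by simp [hQe]⟩
      · obtain ⟨w, hw, hmin⟩ := hQ.exists_isMinOn hQn (continuous_snd.continuousOn)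
        refine ⟨w.2, lt_of_le_of_ne (hCnonneg w.1 w.2 hw.1.1) ?_, hw.2.2.2,
          fun w' hw' => hmin hw'⟩
        intro h0
        have h1 : w.1 ∈ V := hCV w.1 (by rw [h0]; exact hw.1.1)
        have h2 : w.1 = 0 := by
          have := Submodule.inner_right_of_mem_orthogonal h1 hw.1.2
          simpa using this
        have h3 := hw.2.1
        rw [h2] at h3
        simp at h3
    obtain ⟨δ, hδ, hδ1, hmin⟩ := key
    refine ⟨δ, hδ, fun d τ hd hdV => ?_⟩
    by_cases hd0 : d = 0
    · subst hd0; simpa using hCnonneg _ _ hd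
    have hdn : 0 < ‖d‖ := norm_pos_iff.2 hd0
    have h1 := hCsmul d τ ‖d‖⁻¹ (by positivity) hd
    have h2 : δ ≤ ‖d‖⁻¹ * τ := by
      by_cases hle : ‖d‖⁻¹ * τ ≤ 1
      · refine hmin (‖d‖⁻¹ • d, ‖d‖⁻¹ * τ) ⟨⟨h1, Vᗮ.smul_mem _ hdV⟩, ?_, hCnonneg _ _ h1, hle⟩
        simp [norm_smul, hdn.ne']
      · linarith
    calc δ * ‖d‖ ≤ (‖d‖⁻¹ * τ) * ‖d‖ := by gcongr
      _ = τ := by field_simp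
  obtain ⟨ρ, hρ, hVsmall⟩ := hVsmall
  obtain ⟨δ, hδ, hsharp⟩ := hsharp
  -- `C` is invariant under translation by `V` at fixed height.
  have hsharp' : ∀ d τ, (d, τ) ∈ C → δ * ‖d - V.starProjection d‖ ≤ τ := by
    intro d τ hd
    refine hsharp _ _ (fun i hi => ?_) (V.sub_starProjection_mem_orthogonal d)
    have h1 := (hV _).1 (V.starProjection_apply_mem d) i hi
    have h2 := hd i hi
    have : ((d - V.starProjection d, ⟪p₀, d - V.starProjection d⟫ + τ) : E × ℝ) =
        (d, ⟪p₀, d⟫ + τ) - (V.starProjection d, ⟪p₀, V.starProjection d⟫) := by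
      ext
      · simp
      · simp [inner_sub_right]; ring
    show l i (d - V.starProjection d, ⟪p₀, d - V.starProjection d⟫ + τ) ≤ 0
    rw [this, map_sub, h1, sub_zero]
    exact h2
  refine ⟨V, fun k => ⟨fun hk c hc => ?_, fun hk => ?_⟩, ?_⟩
  · have := Submodule.inner_left_of_mem_orthogonal (hCV _ (hMC c hc)) hk
    exact this.le
  · rw [Submodule.mem_orthogonal']
    intro v hv
    have hone : ∀ v ∈ V, ⟪k, v⟫ ≤ 0 := by
      intro v hv
      obtain ⟨ε, hε, hmem⟩ := hCscale v 0 (hVC v hv)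
      have h1 := hk (u₀ + ε • v) (by
        convert! hmem using 2
        rw [inner_add_right, ht₀]; ring)
      rw [add_sub_cancel_left, inner_smul_right] at h1
      exact nonpos_of_mul_nonpos_right h1 hε
    refine le_antisymm (hone v hv) ?_
    have := hone (-v) (V.neg_mem hv)
    rw [inner_neg_right] at this
    linarith
  · have e1 : ∀ᶠ pu : E × E in 𝓝 (p₀, u₀), ‖pu.1 - p₀‖ < δ := by
      have hc : Continuous fun pu : E × E => ‖pu.1 - p₀‖ := by fun_prop
      exact hc.continuousAt.eventually_lt_const (by simpa using hδ)
    have e2 : ∀ᶠ pu : E × E in 𝓝 (p₀, u₀), ‖pu.2 - u₀‖ < ρ / 2 := by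
      have hc : Continuous fun pu : E × E => ‖pu.2 - u₀‖ := by fun_prop
      exact hc.continuousAt.eventually_lt_const (by simpa using half_pos hρ)
    filter_upwards [e1, e2]
    rintro ⟨p, u⟩ hp hu
    obtain ⟨k, rfl⟩ : ∃ k, p = p₀ + k := ⟨p - p₀, by abel⟩
    obtain ⟨d, rfl⟩ : ∃ d, u = u₀ + d := ⟨u - u₀, by abel⟩
    simp only [add_sub_cancel_left] at hp hu ⊢
    constructor
    · rintro ⟨c, hc, hmem⟩
      have hdC := hPC _ _ hmem
      rw [add_sub_cancel_left] at hdC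
      set τ := ⟪p₀ + k, u₀ + d⟫ - c - t₀ - ⟪p₀, d⟫ with hτ
      -- Compares the new minorant at the touching point and at `u₀ + v`. Taking for `v` the
      -- projection of `d`, sharp growth with `‖k‖ < δ` forces `d ∈ V`; taking `v = d - a • w` then
      -- gives `k ∈ Vᗮ`.
      have hle : ∀ v ∈ V, ‖v‖ < ρ → τ ≤ ⟪k, d - v⟫ := by
        intro v hv hvn
        have h1 := hc _ (hVsmall v hv hvn)
        simp only [inner_add_right, inner_add_left, inner_sub_right, ht₀] at h1 hτ ⊢
        linarith
      have hτ0 := hCnonneg _ _ hdC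
      have hproj : ‖V.starProjection d‖ ≤ ‖d‖ := V.norm_starProjection_apply_le d
      have h1 := hle _ (V.starProjection_apply_mem d) (by linarith)
      have h2 := hsharp' _ _ hdC
      have h3 := real_inner_le_norm k (d - V.starProjection d)
      have h4 : ‖d - V.starProjection d‖ = 0 := by
        have := norm_nonneg (d - V.starProjection d)
        nlinarith
      have hdV : d ∈ V := by
        have : d = V.starProjection d := sub_eq_zero.1 (norm_eq_zero.1 h4)
        rw [this]; exact V.starProjection_apply_mem d
      refine ⟨?_, hdV⟩
      rw [Submodule.mem_orthogonal']
      have hone : ∀ w ∈ V, 0 ≤ ⟪k, w⟫ := by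
        intro w hw
        set a := ρ / 2 / (‖w‖ + 1) with ha
        have ha0 : 0 < a := by positivity
        have haw : a * ‖w‖ < ρ / 2 := by
          rw [ha, div_mul_eq_mul_div, div_lt_iff₀ (by positivity)]
          nlinarith
        have h5 := hle (d - a • w) (V.sub_mem hdV (V.smul_mem _ hw)) (by
          refine (norm_sub_le _ _).trans_lt ?_
          rw [norm_smul, Real.norm_of_nonneg ha0.le]
          linarith)
        rw [sub_sub_cancel, inner_smul_right] at h5
        exact nonneg_of_mul_nonneg_right (hτ0.trans h5) ha0
      intro w hw
      have h6 := hone (-w) (V.neg_mem hw)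
      rw [inner_neg_right] at h6
      exact le_antisymm (by linarith) (hone w hw)
    · rintro ⟨hk, hd⟩
      refine ⟨c₀ + ⟪k, u₀ + d⟫, ?_, ?_⟩
      · rintro ⟨z, t⟩ hzt
        have h1 := hsharp' _ _ (hPC _ _ hzt)
        have h2 := real_inner_le_norm k (z - u₀ - V.starProjection (z - u₀))
        have h3 := Submodule.inner_left_of_mem_orthogonal
          (V.starProjection_apply_mem (z - u₀)) hk
        have h4 := Submodule.inner_left_of_mem_orthogonal hd hk
        have h5 : ‖k‖ * ‖z - u₀ - V.starProjection (z - u₀)‖ ≤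
            δ * ‖z - u₀ - V.starProjection (z - u₀)‖ := by gcongr
        rw [inner_sub_right _ (z - u₀), h3] at h2
        simp only [inner_add_right, inner_add_left, inner_sub_right, ht₀] at *
        linarith
      · have := hVsmall d hd (by linarith)
        convert! this using 2
        rw [inner_add_left]; ring

end PolyhedralReduction

/-! ### Differential calculus and convexity of the pairing; uniqueness. -/

section Smooth

lemma ConvexOn.add_inner_le_of_hasGradientAt {E : Type*} [NormedAddCommGroup E]
    [InnerProductSpace ℝ E] [CompleteSpace E] {f : E → ℝ} (hf : ConvexOn ℝ univ f) {v y : E}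
    (hv : HasGradientAt f v y) (y' : E) : f y + ⟪v, y' - y⟫ ≤ f y' := by
  have hline : ConvexOn ℝ univ (fun t : ℝ => f (AffineMap.lineMap y y' t)) := by
    have := hf.comp_affineMap (AffineMap.lineMap y y' : ℝ →ᵃ[ℝ] E)
    simpa using! this
  have hd : HasDerivAt (fun t : ℝ => f (AffineMap.lineMap y y' t)) ⟪v, y' - y⟫ 0 := by
    have h1 : HasFDerivAt f (InnerProductSpace.toDual ℝ E v)
        ((AffineMap.lineMap y y' : ℝ →ᵃ[ℝ] E) 0) := by
      simpa using hv.hasFDerivAt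
    have h2 : HasDerivAt (fun t : ℝ => (AffineMap.lineMap y y' : ℝ →ᵃ[ℝ] E) t) (y' - y) 0 :=
      AffineMap.hasDerivAt_lineMap
    simpa using! h1.comp_hasDerivAt (0 : ℝ) h2
  have := hline.le_slope_of_hasDerivAt (mem_univ 0) (mem_univ 1) one_pos hd
  simp [slope_def_field] at this
  linarith

variable {n m s : ℕ}
  {g : EuclideanSpace ℝ (Fin n) → EuclideanSpace ℝ (Fin m) → ℝ}
  {G : EuclideanSpace ℝ (Fin n) → EuclideanSpace ℝ (Fin m) → EuclideanSpace ℝ (Fin s)}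
  {h : EuclideanSpace ℝ (Fin s) → EReal}

namespace StandingAssumptions

lemma contDiff_g_right (hd : StandingAssumptions g G h) (x : EuclideanSpace ℝ (Fin n)) :
    ContDiff ℝ 2 (g x) :=
  hd.contDiff_g.comp (contDiff_const.prodMk contDiff_id : ContDiff ℝ 2 fun y => (x, y))

lemma contDiff_G_right (hd : StandingAssumptions g G h) (x : EuclideanSpace ℝ (Fin n)) :
    ContDiff ℝ 2 (G x) :=
  hd.contDiff_G.comp (contDiff_const.prodMk contDiff_id : ContDiff ℝ 2 fun y => (x, y))

lemma hasFDerivAt_g (hd : StandingAssumptions g G h) (x : EuclideanSpace ℝ (Fin n))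
    (y : EuclideanSpace ℝ (Fin m)) : HasFDerivAt (g x) (innerSL ℝ (gradY g x y)) y :=
  ((hd.contDiff_g_right x).differentiable two_ne_zero y).hasGradientAt.hasFDerivAt

lemma hasFDerivAt_G (hd : StandingAssumptions g G h) (x : EuclideanSpace ℝ (Fin n))
    (y : EuclideanSpace ℝ (Fin m)) : HasFDerivAt (G x) (jacY G x y) y :=
  ((hd.contDiff_G_right x).differentiable two_ne_zero y).hasFDerivAt

lemma hasGradientAt_pairing (hd : StandingAssumptions g G h) (x : EuclideanSpace ℝ (Fin n))
    (y : EuclideanSpace ℝ (Fin m)) (p : EuclideanSpace ℝ (Fin s)) :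
    HasGradientAt (fun y' => g x y' + ⟪p, G x y'⟫) (gradY g x y + jacYT G x y p) y := by
  rw [hasGradientAt_iff_hasFDerivAt]
  convert! (hd.hasFDerivAt_g x y).add ((hasFDerivAt_const p y).inner ℝ (hd.hasFDerivAt_G x y))
    using 1
  ext v
  simp [jacYT, ContinuousLinearMap.adjoint_inner_left]

/-- Joint regularity in `(x, y, p)`: the gradient is the Riesz image of the parametrized derivative
of a jointly `C²` function, so one order is lost. -/
lemma contDiff_pairing_gradient (hd : StandingAssumptions g G h) :
    ContDiff ℝ 1 (fun q : EuclideanSpace ℝ (Fin n) × EuclideanSpace ℝ (Fin m) ×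
      EuclideanSpace ℝ (Fin s) => gradY g q.1 q.2.1 + jacYT G q.1 q.2.1 q.2.2) := by
  have h1 : ∀ q : EuclideanSpace ℝ (Fin n) × EuclideanSpace ℝ (Fin m) ×
      EuclideanSpace ℝ (Fin s), gradY g q.1 q.2.1 + jacYT G q.1 q.2.1 q.2.2 =
      (InnerProductSpace.toDual ℝ (EuclideanSpace ℝ (Fin m))).symm
        (fderiv ℝ (fun y' => g q.1 y' + ⟪q.2.2, G q.1 y'⟫) q.2.1) := fun q =>
    ((hd.hasGradientAt_pairing q.1 q.2.1 q.2.2).gradient).symm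
  simp_rw [h1]
  refine (InnerProductSpace.toDual ℝ (EuclideanSpace ℝ (Fin m))).symm.contDiff.comp ?_
  refine ContDiff.fderiv (m := 2) ?_ (contDiff_fst.comp contDiff_snd) (by norm_num)
  have e1 : ContDiff ℝ 2 (fun w : (EuclideanSpace ℝ (Fin n) × EuclideanSpace ℝ (Fin m) ×
      EuclideanSpace ℝ (Fin s)) × EuclideanSpace ℝ (Fin m) => g w.1.1 w.2) :=
    hd.contDiff_g.comp ((contDiff_fst.comp contDiff_fst).prodMk contDiff_snd)
  have e2 : ContDiff ℝ 2 (fun w : (EuclideanSpace ℝ (Fin n) × EuclideanSpace ℝ (Fin m) ×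
      EuclideanSpace ℝ (Fin s)) × EuclideanSpace ℝ (Fin m) => G w.1.1 w.2) :=
    hd.contDiff_G.comp ((contDiff_fst.comp contDiff_fst).prodMk contDiff_snd)
  exact e1.add ((contDiff_snd.comp (contDiff_snd.comp contDiff_fst)).inner ℝ e2)

lemma hessLagrangian_eq (hd : StandingAssumptions g G h) (x : EuclideanSpace ℝ (Fin n))
    (y : EuclideanSpace ℝ (Fin m)) (p : EuclideanSpace ℝ (Fin s)) :
    hessLagrangian g G h x y p = fderiv ℝ (fun y' => gradY g x y' + jacYT G x y' p) y := by
  unfold hessLagrangian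
  congr 1
  funext y'
  apply HasGradientAt.gradient
  rw [hasGradientAt_iff_hasFDerivAt]
  simp only [lagrangian, real_inner_comm]
  exact (hd.hasGradientAt_pairing x y' p).hasFDerivAt.sub_const _

lemma convexOn_pairing (hd : StandingAssumptions g G h) (x : EuclideanSpace ℝ (Fin n))
    {p : EuclideanSpace ℝ (Fin s)} (hp : ∀ i, 0 ≤ p i) :
    ConvexOn ℝ univ (fun y => g x y + ⟪p, G x y⟫) := by
  refine (hd.convex_g x).add ?_
  simp only [PiLp.inner_apply]
  refine ⟨convex_univ, fun a _ b _ t r ht hr htr => ?_⟩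
  simp only [smul_eq_mul, Finset.mul_sum, ← Finset.sum_add_distrib]
  refine Finset.sum_le_sum fun i _ => ?_
  have h1 := (hd.convex_G x i).2 (mem_univ a) (mem_univ b) ht hr htr
  have h2 := mul_le_mul_of_nonneg_left h1 (hp i)
  simp only [smul_eq_mul, RCLike.inner_apply, conj_trivial] at h2 ⊢
  linarith

lemma mem_subdiff_iff (hd : StandingAssumptions g G h) {p u : EuclideanSpace ℝ (Fin s)} :
    u ∈ subdiff (conj h) p ↔
      ∃ c : ℝ, (∀ zt ∈ epi h, ⟪p, zt.1⟫ - zt.2 ≤ c) ∧ (u, ⟪p, u⟫ - c) ∈ epi h :=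
  mem_subdiff_conj_iff hd.proper_h hd.epiPolyhedral_h.isClosed hd.epiPolyhedral_h.convex

lemma le_pairing (hd : StandingAssumptions g G h) (x : EuclideanSpace ℝ (Fin n))
    {p : EuclideanSpace ℝ (Fin s)} {c : ℝ} (hp : ∀ zt ∈ epi h, ⟪p, zt.1⟫ - zt.2 ≤ c)
    (y y' : EuclideanSpace ℝ (Fin m)) :
    g x y + ⟪p, G x y⟫ + ⟪gradY g x y + jacYT G x y p, y' - y⟫ ≤ g x y' + ⟪p, G x y'⟫ :=
  ConvexOn.add_inner_le_of_hasGradientAt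
    (hd.convexOn_pairing x (nonneg_of_affine_minorant hd.proper_h hd.nondecreasing_h hp))
    (hd.hasGradientAt_pairing x y p) y'

/-- Strong monotonicity of the regularized optimality system. -/
theorem solReg_subsingleton (hd : StandingAssumptions g G h) {α β : ℝ} (hα : 0 < α) (hβ : 0 < β)
    (x : EuclideanSpace ℝ (Fin n)) : (solReg g G h α β x).Subsingleton := by
  rintro ⟨y₁, p₁⟩ ⟨h1, hu1⟩ ⟨y₂, p₂⟩ ⟨h2, hu2⟩
  obtain ⟨c₁, hc1, hm1⟩ := hd.mem_subdiff_iff.1 hu1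
  obtain ⟨c₂, hc2, hm2⟩ := hd.mem_subdiff_iff.1 hu2
  simp only at h1 h2 hu1 hu2 hc1 hc2 hm1 hm2
  have e1 : gradY g x y₁ + jacYT G x y₁ p₁ = -(β • y₁) := by
    rw [← sub_eq_zero, ← neg_eq_zero, ← h1]; abel
  have e2 : gradY g x y₂ + jacYT G x y₂ p₂ = -(β • y₂) := by
    rw [← sub_eq_zero, ← neg_eq_zero, ← h2]; abel
  have i1 := hd.le_pairing x hc1 y₁ y₂
  have i2 := hd.le_pairing x hc2 y₂ y₁
  have i3 := hc1 _ hm2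
  have i4 := hc2 _ hm1
  rw [e1] at i1
  rw [e2] at i2
  have n1 : ⟪y₁ - y₂, y₁ - y₂⟫ = ‖y₁ - y₂‖ ^ 2 := real_inner_self_eq_norm_sq _
  have n2 : ⟪p₁ - p₂, p₁ - p₂⟫ = ‖p₁ - p₂‖ ^ 2 := real_inner_self_eq_norm_sq _
  -- In the sum of `i1`–`i4` all values of `g`, all pairings with `G` and both constants cancel,
  -- leaving only the regularization terms.
  have key : β * ‖y₁ - y₂‖ ^ 2 + α * ‖p₁ - p₂‖ ^ 2 ≤ 0 := by
    rw [← n1, ← n2]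
    simp only [inner_sub_left, inner_sub_right, inner_neg_left, inner_smul_left, inner_smul_right,
      conj_trivial] at *
    rw [real_inner_comm y₁ y₂] at *
    rw [real_inner_comm p₁ p₂] at *
    linarith
  have k1 : 0 ≤ β * ‖y₁ - y₂‖ ^ 2 := by positivity
  have k2 : 0 ≤ α * ‖p₁ - p₂‖ ^ 2 := by positivity
  have k3 : ‖y₁ - y₂‖ = 0 := by
    have : β * ‖y₁ - y₂‖ ^ 2 = 0 := by linarith
    simpa [hβ.ne'] using this
  have k4 : ‖p₁ - p₂‖ = 0 := by
    have : α * ‖p₁ - p₂‖ ^ 2 = 0 := by linarith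
    simpa [hα.ne'] using this
  exact Prod.ext (sub_eq_zero.1 (norm_eq_zero.1 k3)) (sub_eq_zero.1 (norm_eq_zero.1 k4))

/-- The solutions of the optimality system are the saddle points of a convex-concave function,
so they form a convex set. -/
theorem convex_sol (hd : StandingAssumptions g G h) (x : EuclideanSpace ℝ (Fin n)) :
    Convex ℝ (sol g G h x) := by
  rintro ⟨y₁, p₁⟩ ⟨h1, hu1⟩ ⟨y₂, p₂⟩ ⟨h2, hu2⟩ a b ha hb hab
  obtain ⟨c₁, hc1, hm1⟩ := hd.mem_subdiff_iff.1 hu1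
  obtain ⟨c₂, hc2, hm2⟩ := hd.mem_subdiff_iff.1 hu2
  simp only at h1 h2 hu1 hu2 hc1 hc2 hm1 hm2
  have e1 : gradY g x y₁ + jacYT G x y₁ p₁ = 0 := by
    rw [← neg_eq_zero, ← h1]; abel
  have e2 : gradY g x y₂ + jacYT G x y₂ p₂ = 0 := by
    rw [← neg_eq_zero, ← h2]; abel
  have m1 : ∀ y, g x y₁ + ⟪p₁, G x y₁⟫ ≤ g x y + ⟪p₁, G x y⟫ := fun y => by
    simpa [e1] using hd.le_pairing x hc1 y₁ y
  have m2 : ∀ y, g x y₂ + ⟪p₂, G x y₂⟫ ≤ g x y + ⟪p₂, G x y⟫ := fun y => by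
    simpa [e2] using hd.le_pairing x hc2 y₂ y
  have i3 := hc1 _ hm2
  have i4 := hc2 _ hm1
  have i1 := m1 y₂
  have i2 := m2 y₁
  simp only at i3 i4
  -- The four inequalities form a cycle through the Lagrangian values at the pairs `(yᵢ, pⱼ)`, so
  -- all four values equal `v`.
  set v := g x y₁ + ⟪p₁, G x y₁⟫ - c₁ with hv
  have hv2 : g x y₂ + ⟪p₂, G x y₂⟫ - c₂ = v := by linarith
  have hv12 : g x y₂ + ⟪p₁, G x y₂⟫ - c₁ = v := by linarith
  have hv21 : g x y₁ + ⟪p₂, G x y₁⟫ - c₂ = v := by linarith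
  have hone : ∀ r : ℝ, a * r + b * r = r := fun r => by rw [← add_mul, hab, one_mul]
  have cv : ∀ {p : EuclideanSpace ℝ (Fin s)} {c : ℝ}, (∀ zt ∈ epi h, ⟪p, zt.1⟫ - zt.2 ≤ c) →
      g x y₁ + ⟪p, G x y₁⟫ - c = v → g x y₂ + ⟪p, G x y₂⟫ - c = v →
      g x (a • y₁ + b • y₂) + ⟪p, G x (a • y₁ + b • y₂)⟫ - c ≤ v := by
    intro p c hp hvp hvp'
    have := (hd.convexOn_pairing x
      (nonneg_of_affine_minorant hd.proper_h hd.nondecreasing_h hp)).2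
      (mem_univ y₁) (mem_univ y₂) ha hb hab
    simp only [smul_eq_mul] at this
    rw [show g x y₁ + ⟪p, G x y₁⟫ = v + c by linarith,
      show g x y₂ + ⟪p, G x y₂⟫ = v + c by linarith, hone] at this
    linarith
  have v1 := cv hc1 rfl hv12
  have v2 := cv hc2 hv21 hv2
  have hin : ∀ z, ⟪a • p₁ + b • p₂, z⟫ = a * ⟪p₁, z⟫ + b * ⟪p₂, z⟫ := by
    intro z; simp [inner_add_left, inner_smul_left]
  set y := a • y₁ + b • y₂ with hy
  set p := a • p₁ + b • p₂ with hp
  have hpc : ∀ zt ∈ epi h, ⟪p, zt.1⟫ - zt.2 ≤ a * c₁ + b * c₂ := by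
    intro zt hzt
    have j1 := mul_le_mul_of_nonneg_left (hc1 zt hzt) ha
    have j2 := mul_le_mul_of_nonneg_left (hc2 zt hzt) hb
    rw [hin]
    linarith [hone zt.2]
  have hcomb : ∀ y', g x y' + ⟪p, G x y'⟫ - (a * c₁ + b * c₂) =
      a * (g x y' + ⟪p₁, G x y'⟫ - c₁) + b * (g x y' + ⟪p₂, G x y'⟫ - c₂) := by
    intro y'
    rw [hin]
    linarith [hone (g x y')]
  have hlow : ∀ y', v ≤ g x y' + ⟪p, G x y'⟫ - (a * c₁ + b * c₂) := by
    intro y'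
    rw [hcomb, ← hone v]
    have := m1 y'
    have := m2 y'
    gcongr <;> linarith
  have hup : g x y + ⟪p, G x y⟫ - (a * c₁ + b * c₂) ≤ v := by
    rw [hcomb, ← hone v]
    gcongr
  have hval : g x y + ⟪p, G x y⟫ - (a * c₁ + b * c₂) = v := le_antisymm hup (hlow y)
  refine ⟨?_, ?_⟩
  · have hmin : IsLocalMin (fun y' => g x y' + ⟪p, G x y'⟫) y :=
      Eventually.of_forall fun y' => by have := hlow y'; simp only; linarith
    have h0 := hmin.hasFDerivAt_eq_zero (hd.hasGradientAt_pairing x y p).hasFDerivAt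
    have h0' : gradY g x y + jacYT G x y p = 0 := 
      (InnerProductSpace.toDual ℝ _).map_eq_zero_iff.1 h0
    have : -gradY g x y - jacYT G x y p = -(gradY g x y + jacYT G x y p) := by abel
    show -gradY g x y - jacYT G x y p = 0
    rw [this, h0', neg_zero]
  · refine hd.mem_subdiff_iff.2 ⟨a * c₁ + b * c₂, hpc, ?_⟩
    have hcvx := hd.epiPolyhedral_h.convex hm1 hm2 ha hb hab
    -- Contact at `G x y` uses monotonicity of `h` with convexity of `G`, then convexity of `epi h`,
    -- then convexity of `g`, ending with the saddle value `hval`.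
    have hle1 : h (G x y) ≤ h (a • G x y₁ + b • G x y₂) := by
      refine hd.nondecreasing_h _ _ fun i => ?_
      simpa using (hd.convex_G x i).2 (mem_univ y₁) (mem_univ y₂) ha hb hab
    have hle2 : h (a • G x y₁ + b • G x y₂) ≤
        ((a * (⟪p₁, G x y₁⟫ - c₁) + b * (⟪p₂, G x y₂⟫ - c₂) : ℝ) : EReal) := hcvx
    refine hle1.trans (hle2.trans (EReal.coe_le_coe_iff.2 ?_))
    have hgc := (hd.convex_g x).2 (mem_univ y₁) (mem_univ y₂) ha hb hab
    simp only [smul_eq_mul] at hgc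
    show _ ≤ ⟪p, G x y⟫ - (a * c₁ + b * c₂)
    rw [show ⟪p₁, G x y₁⟫ - c₁ = v - g x y₁ by linarith,
      show ⟪p₂, G x y₂⟫ - c₂ = v - g x y₂ by linarith]
    linarith [hone v]

end StandingAssumptions

end Smooth

/-! ### Existence of regularized solutions through a penalized primal problem. -/

section Existence

variable {n m s : ℕ}
  {g : EuclideanSpace ℝ (Fin n) → EuclideanSpace ℝ (Fin m) → ℝ}
  {G : EuclideanSpace ℝ (Fin n) → EuclideanSpace ℝ (Fin m) → EuclideanSpace ℝ (Fin s)}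
  {h : EuclideanSpace ℝ (Fin s) → EReal}

lemma exists_bound_of_quadratic_le {a : ℝ} (ha : 0 < a) (b D : ℝ) :
    ∃ B : ℝ, ∀ t : ℝ, a * t ^ 2 - b * t ≤ D → t ≤ B := by
  refine ⟨(|D| + |b|) / a + 1, fun t ht => ?_⟩
  by_contra! hlt
  have h1 : 0 ≤ (|D| + |b|) / a := by positivity
  have h2 : |D| + |b| + a < a * t := by
    have := mul_lt_mul_of_pos_left hlt ha
    rwa [mul_add, mul_div_cancel₀ _ ha.ne', mul_one] at this
  have h3 := le_abs_self b
  have h4 := le_abs_self D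
  have h5 : |D| + a < a * t - b := by linarith
  have h6 := abs_nonneg D
  nlinarith

namespace StandingAssumptions

/-- The objective of the regularized lower-level problem, lifted to the epigraph of `h`, attains its
minimum. -/
theorem exists_regularized_minimizer (hd : StandingAssumptions g G h) {α β : ℝ} (hα : 0 < α)
    (hβ : 0 < β) {p₀ : EuclideanSpace ℝ (Fin s)} {c₀ : ℝ}
    (hp₀ : ∀ zt ∈ epi h, ⟪p₀, zt.1⟫ - zt.2 ≤ c₀) (x : EuclideanSpace ℝ (Fin n)) :
    ∃ (y : EuclideanSpace ℝ (Fin m)) (z : EuclideanSpace ℝ (Fin s)) (t : ℝ), (z, t) ∈ epi h ∧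
      ∀ y' z' t', (z', t') ∈ epi h →
        g x y + t + (2 * α)⁻¹ * ‖G x y - z‖ ^ 2 + β / 2 * ‖y‖ ^ 2 ≤
          g x y' + t' + (2 * α)⁻¹ * ‖G x y' - z'‖ ^ 2 + β / 2 * ‖y'‖ ^ 2 := by
  have hgc : Continuous (g x) := (hd.contDiff_g_right x).continuous
  have hGc : Continuous (G x) := (hd.contDiff_G_right x).continuous
  let f : EuclideanSpace ℝ (Fin m) × EuclideanSpace ℝ (Fin s) × ℝ → ℝ := fun w =>
    g x w.1 + w.2.2 + (2 * α)⁻¹ * ‖G x w.1 - w.2.1‖ ^ 2 + β / 2 * ‖w.1‖ ^ 2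
  have hf : Continuous f := by
    show Continuous fun w : EuclideanSpace ℝ (Fin m) × EuclideanSpace ℝ (Fin s) × ℝ =>
      g x w.1 + w.2.2 + (2 * α)⁻¹ * ‖G x w.1 - w.2.1‖ ^ 2 + β / 2 * ‖w.1‖ ^ 2
    fun_prop
  obtain ⟨zt₀, hzt₀⟩ := hd.proper_h.epi_nonempty
  set f₀ := f (0, zt₀)
  let Q := {w : EuclideanSpace ℝ (Fin m) × EuclideanSpace ℝ (Fin s) × ℝ | w.2 ∈ epi h ∧ f w ≤ f₀}
  have hQclosed : IsClosed Q :=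
    (hd.epiPolyhedral_h.isClosed.preimage continuous_snd).inter (isClosed_le hf continuous_const)
  set v := gradY g x 0 + jacYT G x 0 p₀
  set ℓ := g x 0 + ⟪p₀, G x 0⟫
  set D := f₀ + c₀ - ℓ
  -- Coercivity: the minorant of `h` and the tangent at `y = 0` of the convex function `g x + ⟨p₀, G
  -- x⟩` cost only terms linear in `‖y‖` and `‖G x y - z‖`, which the quadratic terms dominate.
  have hbound : ∀ w ∈ Q, (β / 2 * ‖w.1‖ ^ 2 - ‖v‖ * ‖w.1‖) +
      ((2 * α)⁻¹ * ‖G x w.1 - w.2.1‖ ^ 2 - ‖p₀‖ * ‖G x w.1 - w.2.1‖) ≤ D := by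
    rintro ⟨y, z, t⟩ ⟨hzt, hfw⟩
    have h1 := hp₀ _ hzt
    have h2 := hd.le_pairing x hp₀ 0 y
    have h3 : -(‖v‖ * ‖y‖) ≤ ⟪v, y - 0⟫ := by
      rw [sub_zero]; exact neg_le_of_abs_le (abs_real_inner_le_norm v y)
    have h4 := real_inner_le_norm p₀ (G x y - z)
    rw [inner_sub_right] at h4
    simp only [f] at hfw h1 ⊢
    linarith
  have hα2 : 0 < (2 * α)⁻¹ := by positivity
  have hq : ∀ {a : ℝ} (_ : 0 < a) (b r : ℝ), -(b ^ 2 / (4 * a)) ≤ a * r ^ 2 - b * r := by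
    intro a ha b r
    have : a * r ^ 2 - b * r + b ^ 2 / (4 * a) = a * (r - b / (2 * a)) ^ 2 := by field_simp; ring
    have h2 : 0 ≤ a * (r - b / (2 * a)) ^ 2 := by positivity
    linarith
  obtain ⟨B₁, hB₁⟩ := exists_bound_of_quadratic_le (half_pos hβ) ‖v‖
    (D + ‖p₀‖ ^ 2 / (4 * (2 * α)⁻¹))
  obtain ⟨B₂, hB₂⟩ := exists_bound_of_quadratic_le hα2 ‖p₀‖ (D + ‖v‖ ^ 2 / (4 * (β / 2)))
  have hQ₁ : ∀ w ∈ Q, ‖w.1‖ ≤ B₁ := fun w hw =>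
    hB₁ _ (by linarith [hbound w hw, hq hα2 ‖p₀‖ ‖G x w.1 - w.2.1‖])
  have hQ₂ : ∀ w ∈ Q, ‖G x w.1 - w.2.1‖ ≤ B₂ := fun w hw =>
    hB₂ _ (by linarith [hbound w hw, hq (half_pos hβ) ‖v‖ ‖w.1‖])
  let K := Metric.closedBall (0 : EuclideanSpace ℝ (Fin m)) B₁ ×ˢ
    Metric.closedBall (0 : EuclideanSpace ℝ (Fin s)) B₂
  have hK : IsCompact K := (isCompact_closedBall _ _).prod (isCompact_closedBall _ _)
  obtain ⟨R₁, hR₁⟩ := hK.exists_bound_of_continuousOn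
    (f := fun w => ⟪p₀, G x w.1 - w.2⟫) (by fun_prop)
  obtain ⟨R₂, hR₂⟩ := hK.exists_bound_of_continuousOn (f := fun w => g x w.1) (by fun_prop)
  have hQcompact : IsCompact Q := by
    have himg : IsCompact ((fun w : (EuclideanSpace ℝ (Fin m) × EuclideanSpace ℝ (Fin s)) × ℝ =>
        ((w.1.1, G x w.1.1 - w.1.2, w.2) :
          EuclideanSpace ℝ (Fin m) × EuclideanSpace ℝ (Fin s) × ℝ)) ''
        (K ×ˢ Icc (-R₁ - c₀) (f₀ + R₂))) :=
      (hK.prod isCompact_Icc).image (by fun_prop)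
    refine himg.of_isClosed_subset hQclosed ?_
    rintro ⟨y, z, t⟩ hw
    have hmem : (y, G x y - z) ∈ K := ⟨by simpa using hQ₁ _ hw, by simpa using hQ₂ _ hw⟩
    refine ⟨((y, G x y - z), t), ⟨hmem, ?_, ?_⟩, by simp⟩
    · have h1 := hp₀ _ hw.1
      have h2 := neg_le_of_abs_le (hR₁ _ hmem)
      simp only [sub_sub_cancel] at h1 h2 ⊢
      linarith
    · have h1 : g x y + t + (2 * α)⁻¹ * ‖G x y - z‖ ^ 2 + β / 2 * ‖y‖ ^ 2 ≤ f₀ := hw.2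
      have h2 := neg_le_of_abs_le (hR₂ _ hmem)
      have h3 : 0 ≤ (2 * α)⁻¹ * ‖G x y - z‖ ^ 2 := by positivity
      have h4 : 0 ≤ β / 2 * ‖y‖ ^ 2 := by positivity
      simp only at h2 ⊢
      linarith
  obtain ⟨⟨y, z, t⟩, hw, hmin⟩ := hQcompact.exists_isMinOn ⟨(0, zt₀), hzt₀, le_rfl⟩ hf.continuousOn
  refine ⟨y, z, t, hw.1, fun y' z' t' hzt' => ?_⟩
  by_cases hle : f (y', z', t') ≤ f₀
  · exact hmin (show (y', z', t') ∈ Q from ⟨hzt', hle⟩)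
  · exact hw.2.trans (not_le.1 hle).le

theorem solReg_nonempty (hd : StandingAssumptions g G h) {α β : ℝ} (hα : 0 < α)
    (hβ : 0 < β) {p₀ : EuclideanSpace ℝ (Fin s)} {c₀ : ℝ}
    (hp₀ : ∀ zt ∈ epi h, ⟪p₀, zt.1⟫ - zt.2 ≤ c₀) (x : EuclideanSpace ℝ (Fin n)) :
    (solReg g G h α β x).Nonempty := by
  obtain ⟨y, z, t, hzt, hmin⟩ := hd.exists_regularized_minimizer hα hβ hp₀ x
  -- The multiplier is the gradient of the penalty, so `G x y - α • p = z`. Minimality in `y` gives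
  -- stationarity, and minimality in `(z, t)` gives contact at `z`.
  set p := α⁻¹ • (G x y - z) with hp
  have hαp : α • p = G x y - z := by rw [hp, smul_inv_smul₀ hα.ne']
  refine ⟨(y, p), ?_, ?_⟩
  · have hloc : IsLocalMin (fun y' => g x y' + (2 * α)⁻¹ * ‖G x y' - z‖ ^ 2 + β / 2 * ‖y'‖ ^ 2) y :=
      Eventually.of_forall fun y' => by have := hmin y' z t hzt; simp only; linarith
    have hder := ((hd.hasFDerivAt_g x y).add
      ((((hd.hasFDerivAt_G x y).sub_const z).norm_sq).const_mul (2 * α)⁻¹)).add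
      (((hasFDerivAt_id y).norm_sq).const_mul (β / 2))
    have h0 := hloc.hasFDerivAt_eq_zero hder
    have key : gradY g x y + jacYT G x y p + β • y = 0 := by
      refine ext_inner_right ℝ fun w => ?_
      have h1 := DFunLike.congr_fun h0 w
      simp only [add_apply, smul_apply, innerSL_apply_apply,
        ContinuousLinearMap.comp_apply, ContinuousLinearMap.id_apply, id, smul_eq_mul, nsmul_eq_mul,
        zero_apply] at h1
      rw [inner_zero_left, inner_add_left, inner_add_left, jacYT,
        ContinuousLinearMap.adjoint_inner_left, hp, inner_smul_left, inner_smul_left, ← h1]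
      simp
      field_simp
    show -gradY g x y - jacYT G x y p - β • y = 0
    rw [← neg_eq_zero, ← key]; abel
  · show G x y - α • p ∈ subdiff (conj h) p
    rw [hαp, sub_sub_cancel]
    refine hd.mem_subdiff_iff.2 ⟨⟪p, z⟫ - t, ?_, by simpa using hzt⟩
    rintro ⟨z', t'⟩ hzt'
    -- Minimality along the segment from `(z, t)` to `(z', t')`, divided by `ε`; the quadratic
    -- remainder vanishes as `ε → 0`.
    have hseg : ∀ ε ∈ Ioo (0 : ℝ) 1, 0 ≤ (t' - t - ⟪p, z' - z⟫) + ε * ((2 * α)⁻¹ * ‖z' - z‖ ^ 2) := by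
      intro ε hε
      have hc := hd.epiPolyhedral_h.convex hzt hzt' (sub_nonneg.2 hε.2.le) hε.1.le (by ring)
      have h1 := hmin y ((1 - ε) • z + ε • z') ((1 - ε) * t + ε * t') hc
      have h2 : G x y - ((1 - ε) • z + ε • z') = (G x y - z) - ε • (z' - z) := by module
      rw [h2] at h1
      rw [norm_sub_sq_real (G x y - z), inner_smul_right, norm_smul, mul_pow, Real.norm_eq_abs, sq_abs] at h1
      have h3 : ⟪G x y - z, z' - z⟫ = α * ⟪p, z' - z⟫ := by rw [← hαp, inner_smul_left]; rfl
      rw [h3] at h1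
      have h4 : (2 * α)⁻¹ * (‖G x y - z‖ ^ 2 - 2 * (ε * (α * ⟪p, z' - z⟫)) + ε ^ 2 * ‖z' - z‖ ^ 2) =
        (2 * α)⁻¹ * ‖G x y - z‖ ^ 2 - ε * ⟪p, z' - z⟫ + ε * (ε * ((2 * α)⁻¹ * ‖z' - z‖ ^ 2)) := by
        field_simp
      rw [h4] at h1
      have h5 : 0 ≤ ε * ((t' - t - ⟪p, z' - z⟫) + ε * ((2 * α)⁻¹ * ‖z' - z‖ ^ 2)) := by linarith
      exact nonneg_of_mul_nonneg_right h5 hε.1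
    have hlim : Tendsto (fun ε : ℝ => (t' - t - ⟪p, z' - z⟫) + ε * ((2 * α)⁻¹ * ‖z' - z‖ ^ 2))
        (𝓝[>] 0) (𝓝 (t' - t - ⟪p, z' - z⟫)) := by
      have : Continuous fun ε : ℝ =>
        (t' - t - ⟪p, z' - z⟫) + ε * ((2 * α)⁻¹ * ‖z' - z‖ ^ 2) := by fun_prop
      simpa using (this.tendsto 0).mono_left nhdsWithin_le_nhds
    have := ge_of_tendsto hlim (Filter.mem_of_superset (Ioo_mem_nhdsGT one_pos) hseg)
    rw [inner_sub_right] at this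
    simp only
    linarith

end StandingAssumptions

end Existence

/-! ### The implicit function for the perturbed optimality system. -/

section ImplicitSolution

variable {n m s : ℕ}
  {g : EuclideanSpace ℝ (Fin n) → EuclideanSpace ℝ (Fin m) → ℝ}
  {G : EuclideanSpace ℝ (Fin n) → EuclideanSpace ℝ (Fin m) → EuclideanSpace ℝ (Fin s)}
  {h : EuclideanSpace ℝ (Fin s) → EReal}

lemma starProjection_add_starProjection_eq_zero_iff {E : Type*} [NormedAddCommGroup E]
    [InnerProductSpace ℝ E] [FiniteDimensional ℝ E] (V : Submodule ℝ E) (a b : E) :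
    Vᗮ.starProjection a + V.starProjection b = 0 ↔ a ∈ V ∧ b ∈ Vᗮ := by
  constructor
  · intro hab
    have h1 : V.starProjection b ∈ Vᗮ := by
      rw [← neg_eq_of_add_eq_zero_right hab]
      exact Vᗮ.neg_mem (Vᗮ.starProjection_apply_mem a)
    have h2 : V.starProjection b = 0 := by
      have := Submodule.inner_right_of_mem_orthogonal (V.starProjection_apply_mem b) h1
      simpa using this
    rw [h2, add_zero, Submodule.starProjection_apply_eq_zero_iff,
      Submodule.orthogonal_orthogonal] at hab
    exact ⟨hab, V.starProjection_apply_eq_zero_iff.1 h2⟩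
  · rintro ⟨ha, hb⟩
    rw [V.starProjection_apply_eq_zero_iff.2 hb, add_zero,
      Submodule.starProjection_apply_eq_zero_iff, Submodule.orthogonal_orthogonal]
    exact ha

lemma sol_eq_solReg_zero (x : EuclideanSpace ℝ (Fin n)) : sol g G h x = solReg g G h 0 0 x := by
  simp [sol, solReg]

namespace StandingAssumptions

lemma hasFDerivAt_pairing_gradient (hd : StandingAssumptions g G h) (x : EuclideanSpace ℝ (Fin n))
    (y : EuclideanSpace ℝ (Fin m)) (p : EuclideanSpace ℝ (Fin s)) :
    HasFDerivAt (fun q : EuclideanSpace ℝ (Fin m) × EuclideanSpace ℝ (Fin s) =>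
        gradY g x q.1 + jacYT G x q.1 q.2)
      ((hessLagrangian g G h x y p).comp (ContinuousLinearMap.fst ℝ _ _) +
        (jacYT G x y).comp (ContinuousLinearMap.snd ℝ _ _)) (y, p) := by
  have hdiff : DifferentiableAt ℝ (fun q : EuclideanSpace ℝ (Fin m) × EuclideanSpace ℝ (Fin s) =>
      gradY g x q.1 + jacYT G x q.1 q.2) (y, p) := by
    have : ContDiff ℝ 1 (fun q : EuclideanSpace ℝ (Fin m) × EuclideanSpace ℝ (Fin s) =>
        gradY g x q.1 + jacYT G x q.1 q.2) :=
      hd.contDiff_pairing_gradient.comp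
        (contDiff_const.prodMk contDiff_id : ContDiff ℝ 1 fun q => (x, q))
    exact this.differentiable one_ne_zero _
  have h1 := hdiff.hasFDerivAt
  have hy : HasFDerivAt (fun y' => gradY g x y' + jacYT G x y' p) _ y :=
    HasFDerivAt.comp (f := fun y' => (y', p)) y h1 (hasFDerivAt_prodMk_left y p)
  have hp : HasFDerivAt (fun p' => gradY g x y + jacYT G x y p') _ p :=
    HasFDerivAt.comp (f := fun p' => (y, p')) p h1 (hasFDerivAt_prodMk_right y p)
  have hp' : HasFDerivAt (fun p' => gradY g x y + jacYT G x y p') (jacYT G x y) p :=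
    (jacYT G x y).hasFDerivAt.const_add _
  convert! h1 using 1
  rw [hd.hessLagrangian_eq, hy.fderiv, ← hp.unique hp']
  ext1 <;> ext1 w <;> simp [Prod.mk_zero_zero]

/-- Near the base point, the solution set of the perturbed optimality system is the graph of a `C¹`
function of `(x, α, β)`. -/
theorem exists_implicit_solution (hd : StandingAssumptions g G h)
    {xbar : EuclideanSpace ℝ (Fin n)} {ybar : EuclideanSpace ℝ (Fin m)}
    {pbar : EuclideanSpace ℝ (Fin s)} (hsol : (ybar, pbar) ∈ sol g G h xbar)
    (hri : G xbar ybar ∈ intrinsicInterior ℝ (subdiff (conj h) pbar))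
    (hsoc : SecondOrderCondition g G h xbar ybar pbar) :
    ∃ σ : EuclideanSpace ℝ (Fin n) × ℝ × ℝ → EuclideanSpace ℝ (Fin m) × EuclideanSpace ℝ (Fin s),
      ContDiffAt ℝ 1 σ (xbar, 0, 0) ∧ σ (xbar, 0, 0) = (ybar, pbar) ∧
      ∀ᶠ v : (EuclideanSpace ℝ (Fin n) × ℝ × ℝ) ×
          (EuclideanSpace ℝ (Fin m) × EuclideanSpace ℝ (Fin s)) in
        𝓝 ((xbar, 0, 0), (ybar, pbar)),
        v.2 ∈ solReg g G h v.1.2.1 v.1.2.2 v.1.1 ↔ σ v.1 = v.2 := by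
  obtain ⟨hstat, hsub⟩ := hsol
  simp only at hstat hsub
  obtain ⟨c₀, hc₀, hm₀⟩ := hd.mem_subdiff_iff.1 hsub
  -- Any other admissible constant satisfies `c₀ ≤ c`, and epigraphs are closed upwards, so one
  -- constant serves for every `u`.
  have hmem : ∀ u, u ∈ subdiff (conj h) pbar ↔ (u, ⟪pbar, u⟫ - c₀) ∈ epi h := by
    intro u
    refine ⟨fun hu => ?_, fun hu => hd.mem_subdiff_iff.2 ⟨c₀, hc₀, hu⟩⟩
    obtain ⟨c, hc, hm⟩ := hd.mem_subdiff_iff.1 hu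
    have h1 := hc _ hm₀
    simp only at h1
    have hle : ⟪pbar, u⟫ - c ≤ ⟪pbar, u⟫ - c₀ := by linarith
    exact le_trans (show h u ≤ _ from hm) (EReal.coe_le_coe_iff.2 hle)
  obtain ⟨V, hVN, hVloc⟩ := exists_submodule_eventually_contact_iff hd.epiPolyhedral_h hc₀ hm₀
    (fun c hc => by
      obtain ⟨ε, hε, hεm⟩ := exists_pos_sub_smul_mem hri ((hmem c).2 hc)
      exact ⟨ε, hε, (hmem _).1 hεm⟩)
  have hK : ∀ k, k ∈ criticalCone (conj h) pbar (G xbar ybar) ↔ k ∈ Vᗮ := by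
    intro k
    rw [hVN]
    exact forall_congr' fun c => by rw [hmem]
  -- The second component packs `u - G xbar ybar ∈ V` and `p - pbar ∈ Vᗮ` into one equation, its two
  -- summands lying in complementary orthogonal subspaces. This makes the system square.
  let F : (EuclideanSpace ℝ (Fin n) × ℝ × ℝ) ×
      (EuclideanSpace ℝ (Fin m) × EuclideanSpace ℝ (Fin s)) →
      EuclideanSpace ℝ (Fin m) × EuclideanSpace ℝ (Fin s) := fun v =>
    (gradY g v.1.1 v.2.1 + jacYT G v.1.1 v.2.1 v.2.2 + v.1.2.2 • v.2.1,
      Vᗮ.starProjection (G v.1.1 v.2.1 - v.1.2.1 • v.2.2 - G xbar ybar) +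
        V.starProjection (v.2.2 - pbar))
  have hF : ContDiff ℝ 1 F := by
    refine ContDiff.prodMk ?_ ?_
    · refine ContDiff.add ?_ (by fun_prop)
      exact hd.contDiff_pairing_gradient.comp
        ((contDiff_fst.comp contDiff_fst).prodMk contDiff_snd)
    · have hG : ContDiff ℝ 1 (fun v : (EuclideanSpace ℝ (Fin n) × ℝ × ℝ) ×
          (EuclideanSpace ℝ (Fin m) × EuclideanSpace ℝ (Fin s)) => G v.1.1 v.2.1) :=
        (hd.contDiff_G.of_le one_le_two).comp
          ((contDiff_fst.comp contDiff_fst).prodMk (contDiff_fst.comp contDiff_snd))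
      refine ContDiff.add (Vᗮ.starProjection.contDiff.comp ?_) (V.starProjection.contDiff.comp ?_)
      · exact (hG.sub (by fun_prop)).sub contDiff_const
      · fun_prop
  set b : (EuclideanSpace ℝ (Fin n) × ℝ × ℝ) ×
      (EuclideanSpace ℝ (Fin m) × EuclideanSpace ℝ (Fin s)) := ((xbar, 0, 0), (ybar, pbar)) with hb
  have hstat' : gradY g xbar ybar + jacYT G xbar ybar pbar = 0 := by
    rw [← neg_eq_zero, ← hstat]; abel
  have hFb : F b = 0 := by simp [F, hb, hstat']
  let L : EuclideanSpace ℝ (Fin m) × EuclideanSpace ℝ (Fin s) →L[ℝ]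
      EuclideanSpace ℝ (Fin m) × EuclideanSpace ℝ (Fin s) :=
    ((hessLagrangian g G h xbar ybar pbar).comp (ContinuousLinearMap.fst ℝ _ _) +
      (jacYT G xbar ybar).comp (ContinuousLinearMap.snd ℝ _ _)).prod
    (Vᗮ.starProjection.comp ((jacY G xbar ybar).comp (ContinuousLinearMap.fst ℝ _ _)) +
      V.starProjection.comp (ContinuousLinearMap.snd ℝ _ _))
  have hL : fderiv ℝ F b ∘L .inr ℝ _ _ = L := by
    have h1 : HasFDerivAt (fun q => F ((xbar, 0, 0), q)) (fderiv ℝ F b ∘L .inr ℝ _ _)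
        (ybar, pbar) :=
      (hF.differentiable one_ne_zero b).hasFDerivAt.comp (ybar, pbar)
        (hasFDerivAt_prodMk_right (xbar, (0 : ℝ), (0 : ℝ)) (ybar, pbar))
    refine h1.unique ?_
    simp only [F, zero_smul, add_zero, sub_zero]
    refine HasFDerivAt.prodMk (hd.hasFDerivAt_pairing_gradient xbar ybar pbar) (HasFDerivAt.add ?_ ?_)
    · refine Vᗮ.starProjection.hasFDerivAt.comp (ybar, pbar) (HasFDerivAt.sub_const _ ?_)
      exact (hd.hasFDerivAt_G xbar ybar).comp (ybar, pbar) hasFDerivAt_fst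
    · exact V.starProjection.hasFDerivAt.comp (ybar, pbar) (hasFDerivAt_snd.sub_const _)
  -- A kernel vector `(w, z)` has `z ∈ Vᗮ`, the critical cone, and `jacY G xbar ybar w ∈ V`,
  -- orthogonal to that cone: precisely the premises of the second-order condition.
  have hLinj : Function.Injective L := by
    rw [injective_iff_map_eq_zero]
    rintro ⟨w, z⟩ hwz
    have h1 : hessLagrangian g G h xbar ybar pbar w + jacYT G xbar ybar z = 0 :=
      congrArg Prod.fst hwz
    have h2 : Vᗮ.starProjection (jacY G xbar ybar w) + V.starProjection z = 0 :=
      congrArg Prod.snd hwz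
    obtain ⟨hw, hz⟩ := (starProjection_add_starProjection_eq_zero_iff V _ _).1 h2
    obtain ⟨rfl, rfl⟩ := hsoc w z ((hK z).2 hz) (neg_eq_of_add_eq_zero_left h1) (fun k hk =>
      Submodule.inner_left_of_mem_orthogonal (V.neg_mem hw) ((hK k).1 hk))
    rfl
  have hinv : (fderiv ℝ F b ∘L .inr ℝ _ _).IsInvertible := by
    rw [hL]
    exact ⟨(LinearEquiv.ofInjectiveEndo L.toLinearMap hLinj).toContinuousLinearEquiv,
      ContinuousLinearMap.ext fun _ => rfl⟩
  have hFb1 : ContDiffAt ℝ 1 F b := hF.contDiffAt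
  have hiff := hFb1.eventually_apply_eq_iff_implicitFunction one_ne_zero hinv
  refine ⟨hFb1.implicitFunction one_ne_zero hinv,
    hFb1.contDiffAt_implicitFunction one_ne_zero hinv,
    hFb1.implicitFunction_apply_self one_ne_zero hinv, ?_⟩
  have hcont : Tendsto (fun v : (EuclideanSpace ℝ (Fin n) × ℝ × ℝ) ×
      (EuclideanSpace ℝ (Fin m) × EuclideanSpace ℝ (Fin s)) =>
      (v.2.2, G v.1.1 v.2.1 - v.1.2.1 • v.2.2)) (𝓝 b) (𝓝 (pbar, G xbar ybar)) := by
    have hG : Continuous (fun v : (EuclideanSpace ℝ (Fin n) × ℝ × ℝ) ×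
        (EuclideanSpace ℝ (Fin m) × EuclideanSpace ℝ (Fin s)) => G v.1.1 v.2.1) :=
      hd.contDiff_G.continuous.comp
        ((continuous_fst.comp continuous_fst).prodMk (continuous_fst.comp continuous_snd))
    have : Continuous (fun v : (EuclideanSpace ℝ (Fin n) × ℝ × ℝ) ×
        (EuclideanSpace ℝ (Fin m) × EuclideanSpace ℝ (Fin s)) =>
        (v.2.2, G v.1.1 v.2.1 - v.1.2.1 • v.2.2)) :=
      (continuous_snd.comp continuous_snd).prodMk (hG.sub (by fun_prop))
    simpa [hb] using this.tendsto b
  filter_upwards [hiff, hcont.eventually hVloc] with v hv hvV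
  rw [← hv, hFb, Prod.ext_iff]
  refine and_congr ?_ ?_
  · rw [← neg_eq_zero]
    show -(-gradY g v.1.1 v.2.1 - jacYT G v.1.1 v.2.1 v.2.2 - v.1.2.2 • v.2.1) = 0 ↔
      gradY g v.1.1 v.2.1 + jacYT G v.1.1 v.2.1 v.2.2 + v.1.2.2 • v.2.1 = 0
    rw [show -(-gradY g v.1.1 v.2.1 - jacYT G v.1.1 v.2.1 v.2.2 - v.1.2.2 • v.2.1) =
      gradY g v.1.1 v.2.1 + jacYT G v.1.1 v.2.1 v.2.2 + v.1.2.2 • v.2.1 by abel]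
  · exact (hd.mem_subdiff_iff.trans hvV).trans
      (and_comm.trans (starProjection_add_starProjection_eq_zero_iff V _ _).symm)

end StandingAssumptions

/-- A second point would put a whole segment issuing from `a` into `C`, so `a` would not be
isolated. -/
lemma Convex.eq_singleton_of_eventually_eq {E : Type*} [NormedAddCommGroup E] [NormedSpace ℝ E]
    {C : Set E} (hC : Convex ℝ C) {a : E} (ha : ∀ᶠ q in 𝓝 a, q ∈ C ↔ a = q) : C = {a} := by
  have haC : a ∈ C := ha.self_of_nhds.2 rfl
  refine eq_singleton_iff_unique_mem.2 ⟨haC, fun q hq => ?_⟩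
  have hcont : Tendsto (fun t : ℝ => AffineMap.lineMap a q t) (𝓝 0) (𝓝 a) := by
    have : Continuous fun t : ℝ => (AffineMap.lineMap a q : ℝ →ᵃ[ℝ] E) t :=
      AffineMap.lineMap_continuous
    simpa using this.tendsto 0
  obtain ⟨t, ht, ht01⟩ := (((hcont.eventually ha).filter_mono nhdsWithin_le_nhds).and
    (Ioo_mem_nhdsGT (one_pos : (0 : ℝ) < 1))).exists
  have h1 := ht.1 (hC.lineMap_mem haC hq ⟨ht01.1.le, ht01.2.le⟩)
  rw [AffineMap.lineMap_apply] at h1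
  simpa [ht01.1.ne', sub_eq_zero] using h1

end ImplicitSolution

end Bilevel

/-! ### From the local solution map to the global statements. -/

theorem proposition3 {n m s : ℕ}
    (g : EuclideanSpace ℝ (Fin n) → EuclideanSpace ℝ (Fin m) → ℝ)
    (G : EuclideanSpace ℝ (Fin n) → EuclideanSpace ℝ (Fin m) → EuclideanSpace ℝ (Fin s))
    (h : EuclideanSpace ℝ (Fin s) → EReal)
    (hdata : Bilevel.StandingAssumptions g G h)
    (xbar : EuclideanSpace ℝ (Fin n)) (ybar : EuclideanSpace ℝ (Fin m))
    (pbar : EuclideanSpace ℝ (Fin s))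
    (hsol : (ybar, pbar) ∈ Bilevel.sol g G h xbar)
    (hcq : Bilevel.BasicQualification G h xbar ybar)
    (hri : G xbar ybar ∈ intrinsicInterior ℝ (Bilevel.subdiff (Bilevel.conj h) pbar))
    (hsoc : Bilevel.SecondOrderCondition g G h xbar ybar pbar)
    (x : ℕ → EuclideanSpace ℝ (Fin n)) (α β : ℕ → ℝ)
    (hx : Tendsto x atTop (𝓝 xbar))
    (hα_pos : ∀ ν, 0 < α ν) (hα : Tendsto α atTop (𝓝 0))
    (hβ_pos : ∀ ν, 0 < β ν) (hβ : Tendsto β atTop (𝓝 0)) :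
    ∃ (Sreg : ℕ → EuclideanSpace ℝ (Fin n) →
          EuclideanSpace ℝ (Fin m) × EuclideanSpace ℝ (Fin s))
      (S : EuclideanSpace ℝ (Fin n) →
          EuclideanSpace ℝ (Fin m) × EuclideanSpace ℝ (Fin s)),
      (∀ ν x', Bilevel.solReg g G h (α ν) (β ν) x' = {Sreg ν x'}) ∧
      Bilevel.sol g G h xbar = {(ybar, pbar)} ∧
      (∀ᶠ x' in 𝓝 xbar, Bilevel.sol g G h x' = {S x'}) ∧
      ContDiffAt ℝ 1 S xbar ∧
      Tendsto (fun ν => Sreg ν (x ν)) atTop (𝓝 (ybar, pbar)) ∧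
      (∀ᶠ ν in atTop, ContDiffAt ℝ 1 (Sreg ν) (x ν)) ∧
      Tendsto (fun ν => fderiv ℝ (Sreg ν) (x ν)) atTop (𝓝 (fderiv ℝ S xbar)) := by
  obtain ⟨σ, hσ, hσ0, hσiff⟩ := hdata.exists_implicit_solution hsol hri hsoc
  obtain ⟨c₀, hc₀, -⟩ := hdata.mem_subdiff_iff.1 hsol.2
  have hex : ∀ ν x', ∃ q, Bilevel.solReg g G h (α ν) (β ν) x' = {q} := fun ν x' =>
    exists_eq_singleton_iff_nonempty_subsingleton.2
      ⟨hdata.solReg_nonempty (hα_pos ν) (hβ_pos ν) hc₀ x',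
        hdata.solReg_subsingleton (hα_pos ν) (hβ_pos ν) x'⟩
  choose Sreg hSreg using hex
  -- Recentres the local description at `σ θ`, making it an isolated solution for each parameter
  -- near the base point.
  have hgraph : ∀ᶠ θ in 𝓝 (xbar, (0 : ℝ), (0 : ℝ)), ∀ᶠ q in 𝓝 (σ θ),
      q ∈ Bilevel.solReg g G h θ.2.1 θ.2.2 θ.1 ↔ σ θ = q := by
    have hcont : Tendsto (fun θ => (θ, σ θ)) (𝓝 (xbar, (0 : ℝ), (0 : ℝ)))
        (𝓝 ((xbar, (0 : ℝ), (0 : ℝ)), (ybar, pbar))) := by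
      rw [← hσ0]
      exact continuousAt_id.prodMk hσ.continuousAt
    filter_upwards [hcont.eventually hσiff.eventually_nhds] with θ hθ
    exact (Continuous.prodMk_right θ).continuousAt.eventually hθ
  have hslice : ∀ a b : ℝ, ∀ x' : EuclideanSpace ℝ (Fin n),
      HasFDerivAt (fun x'' => (x'', a, b)) (ContinuousLinearMap.inl ℝ _ (ℝ × ℝ)) x' :=
    fun a b x' => hasFDerivAt_prodMk_left x' (a, b)
  have hslice_smooth : ∀ a b : ℝ, ContDiff ℝ 1
      (fun x' : EuclideanSpace ℝ (Fin n) => (x', a, b)) := fun a b =>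
    contDiff_id.prodMk contDiff_const
  have hsingle : ∀ᶠ x' in 𝓝 xbar, Bilevel.sol g G h x' = {σ (x', 0, 0)} := by
    have hcont := ((hslice_smooth 0 0).continuous.tendsto xbar).eventually hgraph
    filter_upwards [hcont] with x' hx'
    refine Bilevel.Convex.eq_singleton_of_eventually_eq (hdata.convex_sol x') ?_
    rw [Bilevel.sol_eq_solReg_zero]
    exact hx'
  have hθ : Tendsto (fun ν => (x ν, α ν, β ν)) atTop (𝓝 (xbar, 0, 0)) :=
    hx.prodMk_nhds (hα.prodMk_nhds hβ)
  -- `σ` solves the regularized system, whose solution is globally unique, so no a priori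
  -- localization of `Sreg` is needed.
  have hloc : ∀ᶠ ν in atTop, Sreg ν =ᶠ[𝓝 (x ν)] fun x' => σ (x', α ν, β ν) := by
    filter_upwards [hθ.eventually hgraph.eventually_nhds] with ν hν
    have := ((hslice_smooth (α ν) (β ν)).continuous.tendsto (x ν)).eventually hν
    filter_upwards [this] with x' hx'
    have hmem : σ (x', α ν, β ν) ∈ Bilevel.solReg g G h (α ν) (β ν) x' := hx'.self_of_nhds.2 rfl
    rw [hSreg] at hmem
    exact hmem.symm
  have hσν : ∀ᶠ ν in atTop, ContDiffAt ℝ 1 σ (x ν, α ν, β ν) :=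
    hθ.eventually (hσ.eventually (by simp))
  have hderiv : ∀ {a b : ℝ} {x' : EuclideanSpace ℝ (Fin n)}, ContDiffAt ℝ 1 σ (x', a, b) →
      fderiv ℝ (fun x'' => σ (x'', a, b)) x' =
        (fderiv ℝ σ (x', a, b)).comp (ContinuousLinearMap.inl ℝ _ (ℝ × ℝ)) := fun {a b x'} hc =>
    ((hc.differentiableAt one_ne_zero).hasFDerivAt.comp x' (hslice a b x')).fderiv
  refine ⟨Sreg, fun x' => σ (x', 0, 0), hSreg, ?_, hsingle, ?_, ?_, ?_, ?_⟩
  · rw [hsingle.self_of_nhds, hσ0]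
  · exact ContDiffAt.comp xbar hσ (hslice_smooth 0 0).contDiffAt
  · have : Tendsto (fun ν => σ (x ν, α ν, β ν)) atTop (𝓝 (ybar, pbar)) := by
      rw [← hσ0]; exact hσ.continuousAt.tendsto.comp hθ
    refine this.congr' ?_
    filter_upwards [hloc] with ν hν using hν.self_of_nhds.symm
  · filter_upwards [hloc, hσν] with ν hν hc
    refine ContDiffAt.congr_of_eventuallyEq ?_ hν
    exact ContDiffAt.comp (x ν) hc (hslice_smooth (α ν) (β ν)).contDiffAt
  · rw [hderiv hσ]
    have hlim : Tendsto (fun ν => (fderiv ℝ σ (x ν, α ν, β ν)).comp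
        (ContinuousLinearMap.inl ℝ (EuclideanSpace ℝ (Fin n)) (ℝ × ℝ))) atTop
        (𝓝 ((fderiv ℝ σ (xbar, 0, 0)).comp
          (ContinuousLinearMap.inl ℝ (EuclideanSpace ℝ (Fin n)) (ℝ × ℝ)))) :=
      ((continuous_id.clm_comp continuous_const).tendsto _).comp
        ((hσ.continuousAt_fderiv one_ne_zero).tendsto.comp hθ)
    refine hlim.congr' ?_
    filter_upwards [hloc, hσν] with ν hν hc
    rw [hν.fderiv_eq, hderiv hc]
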